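/- Let $\mathbb F$ be a field, let $m,n\ge 1$ and $0\le r\le\min(m,n)$ be integers, and put $L=\max(m,n)$. Let $J=\begin{pmatrix} I_r&0\\0&0\end{pmatrix}$ be the $n\times m$ matrix with $1$'s in the first $r$ positions of the leading diagonal and $0$'s elsewhere. Let $\mathcal M_{mn}^J$ be the semigroup of all $m\times n$ matrices over $\mathbb F$ under the operation $X\star Y=XJY$, and let $P=\operatorname{Reg}(\mathcal M_{mn}^J)$ be the subsemigroup of all its regular elements, i.e. of those $X$ for which there is $Y$ with $X=X\star Y\star X$ and $Y=Y\star X\star Y$. For $0\le s\le r$ put $$D_s^J=\{X\in P:\operatorname{rank}X=s\},\qquad I_s^J=\{X\in P:\operatorname{rank}X\le s\}=D_0^J\cup\cdots\cup D_s^J .$$ 1. The (nonempty, two-sided) ideals of $P$ are precisely the sets $I_s^J$, $0\le s\le r$, and they form a chain $I_0^J\subseteq I_1^J\subseteq\cdots\subseteq I_r^J$. For each $0\le s\le r$, the set $D_s^J$ is a $\mathscr D$-class of $P$, and it is the top $\mathscr D$-class in $I_s^J$ (every element of $I_s^J$ is $\le_{\mathscr J}$-below every element of $D_s^J$ in $P$).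 2. If $0\le s<r$, then $I_s^J$ is generated, as a semigroup, by the idempotents in $D_s^J$, that is, by the $X\in D_s^J$ with $X\star X=X$. 3. If $0\le s<r$ and $|\mathbb F|=q<\infty$, then $$\operatorname{rank}(I_s^J)=\operatorname{idrank}(I_s^J)=q^{s(L-r)}\begin{bmatrix} r\\ s\end{bmatrix}_q .$$ Here $\operatorname{rank}(S)$ (respectively $\operatorname{idrank}(S)$) of a semigroup $S$ is the smallest cardinality of a generating set of $S$ (respectively of a generating set of $S$ consisting of idempotents), and $\begin{bmatrix} r\\ s\end{bmatrix}_q=\dfrac{[r]_q!}{[s]_q!\,[r-s]_q!}$ with $[k]_q!=\prod_{i=1}^{k}(1+q+\cdots+q^{i-1})$. -/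

import Mathlib

universe u

section GeneralSemigroups

variable {T : Type u} [Semigroup T]

/-- An element `x` of a semigroup is regular if `x = xyx` and `y = yxy` for some `y`. -/
def IsRegularElement (x : T) : Prop :=
  ∃ y : T, x = x * y * x ∧ y = y * x * y

theorem isRegularElement_of_eq {x : T} (z : T) (h : x = x * z * x) : IsRegularElement x := by
  have h' : x * (z * x) = x := by rw [← mul_assoc]; exact h.symm
  have h'' : x * (z * (x * z)) = x * z := by rw [← mul_assoc z, ← mul_assoc, h']
  refine ⟨z * x * z, ?_, ?_⟩ <;> simp only [mul_assoc, h', h'']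

/-- A (two-sided) ideal of a semigroup: a nonempty subset closed under multiplication
by arbitrary elements on either side. -/
def IsSemigroupIdeal (I : Set T) : Prop :=
  I.Nonempty ∧ ∀ x ∈ I, ∀ t : T, t * x ∈ I ∧ x * t ∈ I

/-- `x ≤_R y` : `x = y a` for some `a ∈ T¹`. -/
def GreenLeR (x y : T) : Prop := x = y ∨ ∃ a : T, x = y * a

/-- `x ≤_L y` : `x = a y` for some `a ∈ T¹`. -/
def GreenLeL (x y : T) : Prop := x = y ∨ ∃ a : T, x = a * y

/-- `x ≤_J y` : `x = a y b` for some `a, b ∈ T¹`. -/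
def GreenLeJ (x y : T) : Prop :=
  x = y ∨ (∃ a : T, x = a * y) ∨ (∃ b : T, x = y * b) ∨ ∃ a b : T, x = a * y * b

theorem GreenLeR.trans' {x y z : T} (h₁ : GreenLeR x y) (h₂ : GreenLeR y z) :
    GreenLeR x z := by
  rcases h₁ with rfl | ⟨a, rfl⟩
  · exact h₂
  · rcases h₂ with rfl | ⟨b, rfl⟩
    · exact Or.inr ⟨a, rfl⟩
    · exact Or.inr ⟨b * a, mul_assoc _ _ _⟩

theorem GreenLeL.trans' {x y z : T} (h₁ : GreenLeL x y) (h₂ : GreenLeL y z) :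
    GreenLeL x z := by
  rcases h₁ with rfl | ⟨a, rfl⟩
  · exact h₂
  · rcases h₂ with rfl | ⟨b, rfl⟩
    · exact Or.inr ⟨a, rfl⟩
    · exact Or.inr ⟨a * b, (mul_assoc _ _ _).symm⟩

variable (T) in
/-- Green's relation `R`. -/
def greenR : Setoid T where
  r x y := GreenLeR x y ∧ GreenLeR y x
  iseqv := ⟨fun _ => ⟨Or.inl rfl, Or.inl rfl⟩, fun h => ⟨h.2, h.1⟩,
    fun h k => ⟨h.1.trans' k.1, k.2.trans' h.2⟩⟩

variable (T) in
/-- Green's relation `L`. -/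
def greenL : Setoid T where
  r x y := GreenLeL x y ∧ GreenLeL y x
  iseqv := ⟨fun _ => ⟨Or.inl rfl, Or.inl rfl⟩, fun h => ⟨h.2, h.1⟩,
    fun h k => ⟨h.1.trans' k.1, k.2.trans' h.2⟩⟩

variable (T) in
/-- Green's relation `D`, the join of `R` and `L` in the lattice of equivalence relations. -/
def greenD : Setoid T := greenR T ⊔ greenL T

/-- `C` is the top `D`-class in the set `I`: it is a `D`-class of the ambient semigroup,
contained in `I`, and every element of `I` lies `≤_J`-below the elements of `C`. -/
def IsTopDClass (C I : Set T) : Prop :=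
  (∃ x : T, C = {y | greenD T x y}) ∧ C ⊆ I ∧ ∀ x ∈ C, ∀ y ∈ I, GreenLeJ y x

/-- The rank of a semigroup `S` (here a subsemigroup of `T`): the smallest cardinality of a
generating set for `S`. -/
noncomputable def semigroupRank (S : Subsemigroup T) : Cardinal.{u} :=
  sInf {c | ∃ Ω : Set T, Subsemigroup.closure Ω = S ∧ Cardinal.mk Ω = c}

/-- The idempotent rank of an idempotent generated semigroup `S` (here a subsemigroup of `T`):
the smallest cardinality of a generating set for `S` consisting of idempotents. -/
noncomputable def semigroupIdrank (S : Subsemigroup T) : Cardinal.{u} :=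
  sInf {c | ∃ Ω : Set T, (∀ x ∈ Ω, IsIdempotentElem x) ∧
    Subsemigroup.closure Ω = S ∧ Cardinal.mk Ω = c}

end GeneralSemigroups

section QBinomial

/-- The `q`-factorial `1 · (1 + q) ⋯ (1 + q + ⋯ + q^(s-1))`. -/
def qFactorial (q s : ℕ) : ℕ :=
  ∏ i ∈ Finset.range s, ∑ j ∈ Finset.range (i + 1), q ^ j

/-- The `q`-binomial coefficient `[m]! / ([s]! [m-s]!)`, for `s ≤ m`; the division is exact,
by `qBinomial_mul`. -/
def qBinomial (q m s : ℕ) : ℕ :=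
  qFactorial q m / (qFactorial q s * qFactorial q (m - s))

theorem qFactorial_succ (q s : ℕ) :
    qFactorial q (s + 1) = qFactorial q s * ∑ j ∈ Finset.range (s + 1), q ^ j :=
  Finset.prod_range_succ _ _

theorem qFactorial_mul_dvd (q k : ℕ) :
    ∀ a b : ℕ, a + b = k → qFactorial q a * qFactorial q b ∣ qFactorial q k := by
  induction k with
  | zero =>
    intro a b h
    obtain ⟨rfl, rfl⟩ : a = 0 ∧ b = 0 := by omega
    simp [qFactorial]
  | succ k ih =>
    intro a b h
    rcases a with _ | a
    · obtain rfl : b = k + 1 := by omega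
      simp [qFactorial]
    · rcases b with _ | b
      · obtain rfl : a = k := by omega
        simp [qFactorial]
      · have e : ∑ j ∈ Finset.range (k + 1), q ^ j =
            ∑ j ∈ Finset.range (a + 1), q ^ j
              + q ^ (a + 1) * ∑ j ∈ Finset.range (b + 1), q ^ j := by
          obtain rfl : k = a + 1 + b := by omega
          rw [show a + 1 + b + 1 = (a + 1) + (b + 1) by omega, Finset.sum_range_add,
            Finset.mul_sum]
          simp only [pow_add]
        rw [qFactorial_succ q k, e, mul_add]
        refine dvd_add ?_ ?_
        · have h1 := Nat.mul_dvd_mul_right (ih a (b + 1) (by omega))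
            (∑ j ∈ Finset.range (a + 1), q ^ j)
          rw [qFactorial_succ q a]
          refine dvd_trans (dvd_of_eq ?_) h1
          ring
        · have h1 := Nat.mul_dvd_mul_right (ih (a + 1) b (by omega))
            (∑ j ∈ Finset.range (b + 1), q ^ j)
          rw [qFactorial_succ q b]
          refine dvd_trans (dvd_of_eq ?_) (dvd_trans h1 ⟨q ^ (a + 1), ?_⟩) <;> ring

theorem qBinomial_mul (q m s : ℕ) (h : s ≤ m) :
    qBinomial q m s * (qFactorial q s * qFactorial q (m - s)) = qFactorial q m :=
  Nat.div_mul_cancel (qFactorial_mul_dvd q m s (m - s) (by omega))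

end QBinomial

section Sandwich

variable {F : Type u} [Field F] {m n : ℕ}

/-- The underlying set of the linear sandwich semigroup `M_{mn}^A(F)`, where `A` is `n × m`:
all `m × n` matrices over `F`. -/
@[ext]
structure Sandwich (A : Matrix (Fin n) (Fin m) F) : Type u where
  toMatrix : Matrix (Fin m) (Fin n) F

/-- The sandwich operation `X ⋆ Y = X A Y`. -/
instance (A : Matrix (Fin n) (Fin m) F) : Semigroup (Sandwich A) where
  mul X Y := ⟨X.toMatrix * A * Y.toMatrix⟩
  mul_assoc X Y Z := by
    apply Sandwich.ext
    change X.toMatrix * A * Y.toMatrix * A * Z.toMatrix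
      = X.toMatrix * A * (Y.toMatrix * A * Z.toMatrix)
    simp only [Matrix.mul_assoc]

theorem Sandwich.toMatrix_mul {A : Matrix (Fin n) (Fin m) F} (X Y : Sandwich A) :
    (X * Y).toMatrix = X.toMatrix * A * Y.toMatrix := rfl

theorem exists_matrix_mul_mul_eq (X : Matrix (Fin m) (Fin n) F) :
    ∃ W : Matrix (Fin n) (Fin m) F, X * W * X = X := by
  obtain ⟨g, hg⟩ := X.toLin'.rangeRestrict.exists_rightInverse_of_surjective
    (LinearMap.range_rangeRestrict _)
  obtain ⟨h, hh⟩ := g.exists_extend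
  refine ⟨LinearMap.toMatrix' h, ?_⟩
  apply Matrix.toLin'.injective
  rw [Matrix.toLin'_mul, Matrix.toLin'_mul, Matrix.toLin'_toMatrix']
  refine LinearMap.ext fun v => ?_
  have h1 : h (X.toLin' v) = g (X.toLin'.rangeRestrict v) :=
    LinearMap.congr_fun hh (X.toLin'.rangeRestrict v)
  have h2 : X.toLin' (g (X.toLin'.rangeRestrict v)) = X.toLin' v :=
    congrArg Subtype.val (LinearMap.congr_fun hg (X.toLin'.rangeRestrict v))
  change X.toLin' (h (X.toLin' v)) = X.toLin' v
  rw [h1, h2]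

/-- `Reg(M_{mn}^A)`: the subsemigroup of all regular elements of the sandwich semigroup. -/
def regSandwich (A : Matrix (Fin n) (Fin m) F) : Subsemigroup (Sandwich A) where
  carrier := {X | IsRegularElement X}
  mul_mem' := by
    rintro X Y ⟨U, hU, -⟩ ⟨V, hV, -⟩
    obtain ⟨W, hW⟩ := exists_matrix_mul_mul_eq
      (A * U.toMatrix * A * X.toMatrix * A * Y.toMatrix * A * V.toMatrix * A)
    refine isRegularElement_of_eq (V * ⟨W⟩ * U) ?_
    have hU' := congrArg Sandwich.toMatrix hU
    have hV' := congrArg Sandwich.toMatrix hV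
    apply Sandwich.ext
    simp only [Sandwich.toMatrix_mul] at hU' hV' ⊢
    generalize X.toMatrix = x, Y.toMatrix = y, U.toMatrix = a, V.toMatrix = b at *
    have hV'' : y * (A * (b * (A * y))) = y := by
      simpa only [Matrix.mul_assoc] using hV'.symm
    have h1 : x * A * y = x * (A * a * A * x * A * y * A * b * A) * y := by
      calc x * A * y = (x * A * a * A * x) * A * (y * A * b * A * y) := by rw [← hU', ← hV']
        _ = _ := by simp only [Matrix.mul_assoc]
    calc x * A * y
        = x * (A * a * A * x * A * y * A * b * A * W *
            (A * a * A * x * A * y * A * b * A)) * y := by rw [hW]; exact h1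
      _ = (x * A * a * A * x) * A * y * A * b * A * W * A * a * A * x * A *
            (y * (A * (b * (A * y)))) := by simp only [Matrix.mul_assoc]
      _ = x * A * y * A * b * A * W * A * a * A * x * A * y := by rw [← hU', hV'']
      _ = _ := by simp only [Matrix.mul_assoc]

/-- The `n × m` matrix `J_{nmr}` with `1`'s in the first `r` positions on the leading diagonal
and `0`'s elsewhere (used for `r ≤ min(m, n)`). -/
def matrixJ (F : Type u) [Field F] (n m r : ℕ) : Matrix (Fin n) (Fin m) F :=
  Matrix.of fun i j => if (i : ℕ) = (j : ℕ) ∧ (i : ℕ) < r then 1 else 0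

/-- The semigroup `P = Reg(M_{mn}^J)`, where `J = J_{nmr}`. -/
abbrev regP (F : Type u) [Field F] (m n r : ℕ) : Subsemigroup (Sandwich (matrixJ F n m r)) :=
  regSandwich (matrixJ F n m r)

/-- The rank of the matrix `X ∈ P`. -/
noncomputable def rankP {r : ℕ} (X : regP F m n r) : ℕ := X.1.toMatrix.rank

/-- `D_s^J = {X ∈ P : rank X = s}`. -/
def dClassP (F : Type u) [Field F] (m n r s : ℕ) : Set (regP F m n r) :=
  {X | rankP X = s}

/-- `I_s^J = {X ∈ P : rank X ≤ s}`, as a subsemigroup of `P`. -/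
def idealP (F : Type u) [Field F] (m n r s : ℕ) : Subsemigroup (regP F m n r) where
  carrier := {X | rankP X ≤ s}
  mul_mem' := by
    intro X Y hX _
    refine le_trans ?_ (show X.1.toMatrix.rank ≤ s from hX)
    change (X.1.toMatrix * matrixJ F n m r * Y.1.toMatrix).rank ≤ X.1.toMatrix.rank
    rw [Matrix.mul_assoc]
    exact Matrix.rank_mul_le_left _ _

end Sandwich

/-! Write A for the n × m sandwich matrix. Cancelling the outer factors in X = XAYAX shows that the
regular elements of rank s are the products PQ in which P has s columns that stay independent under
A and Q has s rows that do (`exists_frames`, `isRegularElement_frame_mul`). Up to GL_s, P gives the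
R-class and Q the L-class, and PQ is idempotent exactly when QAP = 1. Frames recombine freely, so
the rank determines the D-class and, through `exists_mul_mul_eq_of_rank_le`, the ideals.

If s < rank A, a spare direction lets one frame be turned into any other column by column, with
consecutive frames sharing a dual (`reflTransGen_frameLinked`). If Q₁ is dual to both P and P₁, then
PQ = (PQ₁) ⋆ (P₁Q) splits off an idempotent; hence idempotents generate rank s. Lower ranks follow
because an element of rank t ≤ rank A − 2 is a product of two of rank t + 1.

Over a finite field, every R-class and every L-class of rank s must contain a generator, which gives
the lower bound (`mk_frameClass_le_of_closure_eq`). For the upper bound, join an R-class to an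
L-class when they meet in an idempotent. This bipartite graph is connected and biregular, so Hall's
theorem gives a map along its edges from the larger side to the smaller with fibres of equal size,
and the corresponding idempotents suffice (`exists_map_altChain`, `mem_of_altChain`). For A = J the
classes are counted by choosing s independent vectors in F^r, filling the other rows freely and
dividing by |GL_s|. -/

section Frames

/-! ### Frames and the factorization of regular elements -/

open Matrix

/-- Every matrix of rank `s` factors as a left invertible matrix with `s` columns times a right
invertible matrix with `s` rows. -/
theorem Matrix.exists_rank_factorization {F : Type u} [Field F] {m n s : ℕ}
    (X : Matrix (Fin m) (Fin n) F) (h : X.rank = s) :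
    ∃ (P : Matrix (Fin m) (Fin s) F) (Q : Matrix (Fin s) (Fin n) F)
      (L : Matrix (Fin s) (Fin m) F) (R : Matrix (Fin n) (Fin s) F),
      X = P * Q ∧ L * P = 1 ∧ Q * R = 1 := by
  let b : Module.Basis (Fin s) F (LinearMap.range X.toLin') :=
    Module.finBasisOfFinrankEq F _ (by
      rw [← h, Matrix.rank, ← Matrix.toLin'_apply'])
  let p : (Fin s → F) →ₗ[F] (Fin m → F) :=
    (LinearMap.range X.toLin').subtype ∘ₗ b.equivFun.symm.toLinearMap
  let q : (Fin n → F) →ₗ[F] (Fin s → F) := b.equivFun.toLinearMap ∘ₗ X.toLin'.rangeRestrict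
  have hp : LinearMap.ker p = ⊥ := by
    rw [LinearMap.ker_eq_bot]
    exact Subtype.val_injective.comp b.equivFun.symm.injective
  have hq : LinearMap.range q = ⊤ := by
    rw [LinearMap.range_eq_top]
    exact b.equivFun.surjective.comp X.toLin'.surjective_rangeRestrict
  obtain ⟨l, hl⟩ := p.exists_leftInverse_of_injective hp
  obtain ⟨r, hr⟩ := q.exists_rightInverse_of_surjective hq
  have hpq : p ∘ₗ q = X.toLin' := by
    ext v
    simp [p, q]
  refine ⟨LinearMap.toMatrix' p, LinearMap.toMatrix' q, LinearMap.toMatrix' l,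
    LinearMap.toMatrix' r, ?_, ?_, ?_⟩
  · rw [← LinearMap.toMatrix'_comp, hpq, LinearMap.toMatrix'_toLin']
  · rw [← LinearMap.toMatrix'_comp, hl, LinearMap.toMatrix'_id]
  · rw [← LinearMap.toMatrix'_comp, hr, LinearMap.toMatrix'_id]

variable {F : Type u} [Field F] {m n : ℕ} {A : Matrix (Fin n) (Fin m) F}
  {ι κ : Type*} [Fintype ι] [DecidableEq ι] [Fintype κ] [DecidableEq κ]

/-- The columns of `P` remain linearly independent after applying `A`. -/
def IsColFrame (A : Matrix (Fin n) (Fin m) F) (P : Matrix (Fin m) ι F) : Prop :=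
  ∃ Q : Matrix ι (Fin n) F, Q * A * P = 1

/-- The rows of `Q` remain linearly independent after applying `A`. -/
def IsRowFrame (A : Matrix (Fin n) (Fin m) F) (Q : Matrix ι (Fin n) F) : Prop :=
  ∃ P : Matrix (Fin m) ι F, Q * A * P = 1

omit [Fintype ι] in
theorem isColFrame_of_dual {P : Matrix (Fin m) ι F} {Q : Matrix ι (Fin n) F}
    (h : Q * A * P = 1) : IsColFrame A P := ⟨Q, h⟩

omit [Fintype ι] in
theorem isRowFrame_of_dual {P : Matrix (Fin m) ι F} {Q : Matrix ι (Fin n) F}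
    (h : Q * A * P = 1) : IsRowFrame A Q := ⟨P, h⟩

theorem IsColFrame.mul_left_cancel {P : Matrix (Fin m) ι F} (hP : IsColFrame A P)
    {κ : Type*} {M N : Matrix ι κ F} (h : P * M = P * N) : M = N := by
  obtain ⟨Q, hQ⟩ := hP
  have := congrArg (Q * A * ·) h
  simpa only [← Matrix.mul_assoc, hQ, Matrix.one_mul] using this

theorem IsRowFrame.mul_right_cancel {Q : Matrix ι (Fin n) F} (hQ : IsRowFrame A Q)
    {κ : Type*} {M N : Matrix κ ι F} (h : M * Q = N * Q) : M = N := by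
  obtain ⟨P, hP⟩ := hQ
  have := congrArg (fun Z => Z * (A * P)) h
  rw [Matrix.mul_assoc] at hP
  simpa only [Matrix.mul_assoc, hP, Matrix.mul_one] using this

/-- M may be rectangular or singular: a generalized inverse N of M, placed between duals of Q and P,
gives one for PMQ under ⋆. -/
theorem isRegularElement_frame_mul {P : Matrix (Fin m) ι F} {Q : Matrix κ (Fin n) F}
    (hP : IsColFrame A P) (hQ : IsRowFrame A Q) (M : Matrix ι κ F) :
    IsRegularElement (⟨P * M * Q⟩ : Sandwich A) := by
  obtain ⟨Q₀, h₁⟩ := hP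
  obtain ⟨P₀, h₂⟩ := hQ
  obtain ⟨N, hN⟩ : ∃ N : Matrix κ ι F, M * N * M = M := by
    obtain ⟨W, hW⟩ := exists_matrix_mul_mul_eq (P * M * Q)
    refine ⟨Q * W * P, IsColFrame.mul_left_cancel ⟨Q₀, h₁⟩
      (IsRowFrame.mul_right_cancel ⟨P₀, h₂⟩ ?_)⟩
    calc P * (M * (Q * W * P) * M) * Q = P * M * Q * W * (P * M * Q) := by
          simp only [Matrix.mul_assoc]
      _ = P * M * Q := hW
  refine isRegularElement_of_eq ⟨P₀ * N * Q₀⟩ (Sandwich.ext ?_)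
  simp only [Sandwich.toMatrix_mul]
  calc P * M * Q = P * (M * (1 : Matrix κ κ F) * N * (1 : Matrix ι ι F) * M) * Q := by
        rw [Matrix.mul_one, Matrix.mul_one, hN]
    _ = P * (M * (Q * A * P₀) * N * (Q₀ * A * P) * M) * Q := by rw [h₁, h₂]
    _ = _ := by simp only [Matrix.mul_assoc]

/-- The regular element `P M Q` of the sandwich semigroup. -/
def frameMul {P : Matrix (Fin m) ι F} {Q : Matrix κ (Fin n) F}
    (hP : IsColFrame A P) (hQ : IsRowFrame A Q) (M : Matrix ι κ F) : regSandwich A :=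
  ⟨⟨P * M * Q⟩, isRegularElement_frame_mul hP hQ M⟩

theorem regSandwich_ext {X Y : regSandwich A} (h : X.1.toMatrix = Y.1.toMatrix) : X = Y :=
  Subtype.ext (Sandwich.ext h)

theorem regSandwich_toMatrix_mul (X Y : regSandwich A) :
    (X * Y).1.toMatrix = X.1.toMatrix * A * Y.1.toMatrix := rfl

theorem frameMul_toMatrix {P : Matrix (Fin m) ι F} {Q : Matrix κ (Fin n) F}
    (hP : IsColFrame A P) (hQ : IsRowFrame A Q) (M : Matrix ι κ F) :
    (frameMul hP hQ M).1.toMatrix = P * M * Q := rfl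

/-- Cancelling P on the left and Q on the right of X = XAYAX leaves QAYAP = 1, which exhibits a dual
for each factor. -/
theorem exists_frames (X : regSandwich A) {s : ℕ} (h : X.1.toMatrix.rank = s) :
    ∃ (P : Matrix (Fin m) (Fin s) F) (Q : Matrix (Fin s) (Fin n) F),
      IsColFrame A P ∧ IsRowFrame A Q ∧ X.1.toMatrix = P * Q := by
  obtain ⟨P, Q, L, R, hX, hL, hR⟩ := X.1.toMatrix.exists_rank_factorization h
  obtain ⟨Y, hY, -⟩ := X.2
  have hY' := congrArg Sandwich.toMatrix hY
  simp only [Sandwich.toMatrix_mul] at hY'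
  have key : Q * A * Y.toMatrix * A * P = 1 := by
    rw [hX] at hY'
    calc Q * A * Y.toMatrix * A * P
        = (L * P) * (Q * A * Y.toMatrix * A * P) * (Q * R) := by
          rw [hL, hR, Matrix.one_mul, Matrix.mul_one]
      _ = L * (P * Q * A * Y.toMatrix * A * (P * Q)) * R := by simp only [Matrix.mul_assoc]
      _ = L * (P * Q) * R := by rw [← hY']
      _ = (L * P) * (Q * R) := by simp only [Matrix.mul_assoc]
      _ = 1 := by rw [hL, hR, Matrix.one_mul]
  exact ⟨P, Q, ⟨Q * A * Y.toMatrix, key⟩, ⟨Y.toMatrix * A * P, by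
    rw [← key]; simp only [Matrix.mul_assoc]⟩, hX⟩

theorem rank_frame_mul {P : Matrix (Fin m) ι F} {Q : Matrix ι (Fin n) F}
    (hP : IsColFrame A P) (hQ : IsRowFrame A Q) : (P * Q).rank = Fintype.card ι := by
  obtain ⟨Q₀, h₁⟩ := hP
  obtain ⟨P₀, h₂⟩ := hQ
  apply le_antisymm
  · exact (Matrix.rank_mul_le_left _ _).trans (Matrix.rank_le_card_width _)
  · have h : (Q₀ * A) * (P * Q) * (A * P₀) = 1 := by
      calc (Q₀ * A) * (P * Q) * (A * P₀) = (Q₀ * A * P) * (Q * A * P₀) := by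
            simp only [Matrix.mul_assoc]
        _ = 1 := by rw [h₁, h₂, Matrix.one_mul]
    calc Fintype.card ι = ((Q₀ * A) * (P * Q) * (A * P₀)).rank := by rw [h, Matrix.rank_one]
      _ ≤ _ := (Matrix.rank_mul_le_left _ _).trans (Matrix.rank_mul_le_right _ _)

theorem card_le_rank_of_dual {P : Matrix (Fin m) ι F} {Q : Matrix ι (Fin n) F}
    (h : Q * A * P = 1) : Fintype.card ι ≤ A.rank := by
  calc Fintype.card ι = (Q * A * P).rank := by rw [h, Matrix.rank_one]
    _ ≤ _ := (Matrix.rank_mul_le_left _ _).trans (Matrix.rank_mul_le_right _ _)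

theorem rank_regSandwich_le (X : regSandwich A) : X.1.toMatrix.rank ≤ A.rank := by
  obtain ⟨P, Q, ⟨Q₀, hQ₀⟩, -, -⟩ := exists_frames X rfl
  simpa using card_le_rank_of_dual hQ₀

theorem exists_dual_frames {s : ℕ} (hs : s ≤ A.rank) :
    ∃ (P : Matrix (Fin m) (Fin s) F) (Q : Matrix (Fin s) (Fin n) F), Q * A * P = 1 := by
  obtain ⟨r, hr⟩ : ∃ r, A.rank = r := ⟨_, rfl⟩
  rw [hr] at hs
  obtain ⟨B, C, L, R, hA, hL, hR⟩ := A.exists_rank_factorization hr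
  refine ⟨R.submatrix id (Fin.castLE hs), L.submatrix (Fin.castLE hs) id, ?_⟩
  have h : L * A * R = 1 := by
    rw [hA]
    calc L * (B * C) * R = (L * B) * (C * R) := by simp only [Matrix.mul_assoc]
      _ = 1 := by rw [hL, hR, Matrix.one_mul]
  have : L.submatrix (Fin.castLE hs) id * A * R.submatrix id (Fin.castLE hs) =
      (L * A * R).submatrix (Fin.castLE hs) (Fin.castLE hs) := by
    ext i j
    simp [Matrix.mul_apply]
  rw [this, h, Matrix.submatrix_one _ (Fin.castLE_injective hs)]

/-- Duals of the frames of X strip it down to the identity of size s, which the truncated identity E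
cuts to size t between the frames of Y. -/
theorem exists_mul_mul_eq_of_rank_le (X Y : regSandwich A)
    (h : Y.1.toMatrix.rank ≤ X.1.toMatrix.rank) : ∃ a b : regSandwich A, Y = a * X * b := by
  obtain ⟨s, hs⟩ : ∃ s, X.1.toMatrix.rank = s := ⟨_, rfl⟩
  obtain ⟨t, ht⟩ : ∃ t, Y.1.toMatrix.rank = t := ⟨_, rfl⟩
  rw [hs, ht] at h
  obtain ⟨P, Q, hP, hQ, hX⟩ := exists_frames X hs
  obtain ⟨P', Q', hP', hQ', hY⟩ := exists_frames Y ht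
  obtain ⟨Q₀, h₁⟩ := id hP
  obtain ⟨P₀, h₂⟩ := id hQ
  let E : Matrix (Fin t) (Fin s) F := (1 : Matrix _ _ F).submatrix (Fin.castLE h) id
  have hE : E * Eᵀ = 1 := by
    ext i j
    simp [E, Matrix.mul_apply, Matrix.one_apply]
  refine ⟨frameMul hP' (isRowFrame_of_dual h₁) E, frameMul (isColFrame_of_dual h₂) hQ' Eᵀ, regSandwich_ext ?_⟩
  rw [regSandwich_toMatrix_mul, regSandwich_toMatrix_mul, frameMul_toMatrix, frameMul_toMatrix,
    hX, hY]
  calc P' * Q' = P' * (E * (1 : Matrix (Fin s) (Fin s) F) *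
          (1 : Matrix (Fin s) (Fin s) F) * Eᵀ) * Q' := by
        rw [Matrix.mul_one, Matrix.mul_one, hE, Matrix.mul_one]
    _ = P' * (E * (Q₀ * A * P) * (Q * A * P₀) * Eᵀ) * Q' := by rw [h₁, h₂]
    _ = _ := by simp only [Matrix.mul_assoc]

end Frames

/-! ### Green's relations and ideals -/

section GreenClasses

open Matrix

variable {F : Type u} [Field F] {m n : ℕ} {A : Matrix (Fin n) (Fin m) F}

theorem rank_mul_le_of_regSandwich (X Y : regSandwich A) :
    (X * Y).1.toMatrix.rank ≤ X.1.toMatrix.rank ∧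
      (X * Y).1.toMatrix.rank ≤ Y.1.toMatrix.rank := by
  rw [regSandwich_toMatrix_mul]
  refine ⟨?_, Matrix.rank_mul_le_right _ _⟩
  rw [Matrix.mul_assoc]
  exact Matrix.rank_mul_le_left _ _

/-- Since D is a join of equivalence relations, it is enough that R and L each preserve rank. -/
theorem rank_eq_of_greenD {X Y : regSandwich A} (h : greenD (regSandwich A) X Y) :
    X.1.toMatrix.rank = Y.1.toMatrix.rank := by
  have key : greenD (regSandwich A) ≤
      Setoid.ker (fun X : regSandwich A => X.1.toMatrix.rank) := by
    refine sup_le ?_ ?_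
    · have hle : ∀ X Y : regSandwich A, GreenLeR X Y → X.1.toMatrix.rank ≤ Y.1.toMatrix.rank := by
        rintro X Y (rfl | ⟨a, rfl⟩)
        exacts [le_rfl, (rank_mul_le_of_regSandwich _ _).1]
      exact fun X Y h => le_antisymm (hle _ _ h.1) (hle _ _ h.2)
    · have hle : ∀ X Y : regSandwich A, GreenLeL X Y → X.1.toMatrix.rank ≤ Y.1.toMatrix.rank := by
        rintro X Y (rfl | ⟨a, rfl⟩)
        exacts [le_rfl, (rank_mul_le_of_regSandwich _ _).2]
      exact fun X Y h => le_antisymm (hle _ _ h.1) (hle _ _ h.2)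
  exact key h

/-- The mixed product PQ' is R-related to X = PQ and L-related to Y = P'Q'. -/
theorem greenD_of_rank_eq {X Y : regSandwich A}
    (h : X.1.toMatrix.rank = Y.1.toMatrix.rank) : greenD (regSandwich A) X Y := by
  obtain ⟨s, hs⟩ : ∃ s, X.1.toMatrix.rank = s := ⟨_, rfl⟩
  obtain ⟨P, Q, hP, hQ, hX⟩ := exists_frames X hs
  obtain ⟨P', Q', hP', hQ', hY⟩ := exists_frames Y (h.symm.trans hs)
  have hle : ∀ {P P' : Matrix (Fin m) (Fin s) F} {Q Q' : Matrix (Fin s) (Fin n) F}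
      {X Y : regSandwich A} (_ : IsRowFrame A Q) (_ : IsRowFrame A Q') (_ : IsColFrame A P)
      (_ : IsColFrame A P') (_ : X.1.toMatrix = P * Q),
      (Y.1.toMatrix = P * Q' → GreenLeR X Y) ∧ (Y.1.toMatrix = P' * Q → GreenLeL X Y) := by
    intro P P' Q Q' X Y hQ hQ' hP hP' hX
    constructor
    · intro hY
      obtain ⟨P₀, h₀⟩ := hQ'
      refine Or.inr ⟨frameMul (isColFrame_of_dual h₀) hQ 1, regSandwich_ext ?_⟩
      rw [regSandwich_toMatrix_mul, frameMul_toMatrix, hX, hY, Matrix.mul_one]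
      calc P * Q = P * (Q' * A * P₀) * Q := by rw [h₀, Matrix.mul_one]
        _ = _ := by simp only [Matrix.mul_assoc]
    · intro hY
      obtain ⟨Q₀, h₀⟩ := hP'
      refine Or.inr ⟨frameMul hP (isRowFrame_of_dual h₀) 1, regSandwich_ext ?_⟩
      rw [regSandwich_toMatrix_mul, frameMul_toMatrix, hX, hY, Matrix.mul_one]
      calc P * Q = P * (Q₀ * A * P') * Q := by rw [h₀, Matrix.mul_one]
        _ = _ := by simp only [Matrix.mul_assoc]
  have hZ : (frameMul hP hQ' 1).1.toMatrix = P * Q' := by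
    rw [frameMul_toMatrix, Matrix.mul_one]
  have hR : greenR (regSandwich A) X (frameMul hP hQ' 1) :=
    ⟨(hle hQ hQ' hP hP hX).1 hZ, (hle hQ' hQ hP hP hZ).1 hX⟩
  have hL : greenL (regSandwich A) (frameMul hP hQ' 1) Y :=
    ⟨(hle hQ' hQ' hP hP' hZ).2 hY, (hle hQ' hQ' hP' hP hY).2 hZ⟩
  exact (greenD _).trans' ((le_sup_left : greenR _ ≤ greenD _) hR)
    ((le_sup_right : greenL _ ≤ greenD _) hL)

theorem exists_regSandwich_rank_eq {s : ℕ} (hs : s ≤ A.rank) :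
    ∃ X : regSandwich A, X.1.toMatrix.rank = s := by
  obtain ⟨P, Q, h⟩ := exists_dual_frames hs
  refine ⟨frameMul (isColFrame_of_dual h) (isRowFrame_of_dual h) 1, ?_⟩
  rw [frameMul_toMatrix, Matrix.mul_one,
    rank_frame_mul (isColFrame_of_dual h) (isRowFrame_of_dual h), Fintype.card_fin]

/-- An ideal is determined by an element of maximal rank, since that element generates everything of
at most its rank. -/
theorem isSemigroupIdeal_iff (I : Set (regSandwich A)) :
    IsSemigroupIdeal I ↔ ∃ s ≤ A.rank, I = {X | X.1.toMatrix.rank ≤ s} := by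
  constructor
  · rintro ⟨⟨X₁, hX₁⟩, hI⟩
    obtain ⟨X, hX, hmax⟩ : ∃ X ∈ I, ∀ Y ∈ I, Y.1.toMatrix.rank ≤ X.1.toMatrix.rank := by
      have hfin : ((fun X : regSandwich A => X.1.toMatrix.rank) '' I).Finite :=
        (Set.finite_Iic A.rank).subset (by rintro _ ⟨X, -, rfl⟩; exact rank_regSandwich_le X)
      obtain ⟨_, ⟨X, hX, rfl⟩, h⟩ := Set.exists_max_image _ id hfin ⟨_, X₁, hX₁, rfl⟩
      exact ⟨X, hX, fun Y hY => h _ ⟨Y, hY, rfl⟩⟩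
    refine ⟨_, rank_regSandwich_le X, Set.ext fun Y => ⟨hmax Y, fun hY => ?_⟩⟩
    obtain ⟨a, b, rfl⟩ := exists_mul_mul_eq_of_rank_le X Y hY
    exact (hI _ (hI X hX a).1 b).2
  · rintro ⟨s, hs, rfl⟩
    refine ⟨?_, fun X hX t => ⟨(rank_mul_le_of_regSandwich _ _).2.trans hX,
      (rank_mul_le_of_regSandwich _ _).1.trans hX⟩⟩
    obtain ⟨X, hX⟩ := exists_regSandwich_rank_eq hs
    exact ⟨X, hX.le⟩

theorem isTopDClass_rank {s : ℕ} (hs : s ≤ A.rank) :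
    IsTopDClass {X : regSandwich A | X.1.toMatrix.rank = s} {X | X.1.toMatrix.rank ≤ s} := by
  obtain ⟨X, hX⟩ := exists_regSandwich_rank_eq hs
  refine ⟨⟨X, Set.ext fun Y => ⟨fun hY => greenD_of_rank_eq (hX.trans (Eq.symm hY)),
    fun hY => (rank_eq_of_greenD hY).symm.trans hX⟩⟩, fun Y hY => le_of_eq hY,
    fun X hX Y hY => Or.inr (Or.inr (Or.inr ?_))⟩
  exact exists_mul_mul_eq_of_rank_le X Y (le_trans hY (Eq.ge hX))

end GreenClasses

/-! ### Connecting frames through common duals -/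

section IdempotentGeneration

open Matrix

variable {F : Type u} [Field F] {m n : ℕ} {A : Matrix (Fin n) (Fin m) F}
  {ι : Type*} [Fintype ι] [DecidableEq ι]

/-- Two frames with a common dual frame. -/
def FrameLinked (A : Matrix (Fin n) (Fin m) F) (P P' : Matrix (Fin m) ι F) : Prop :=
  ∃ Q : Matrix ι (Fin n) F, Q * A * P = 1 ∧ Q * A * P' = 1

omit [DecidableEq ι] in
theorem exists_mulVec_notMem_range (P : Matrix (Fin m) ι F) (h : Fintype.card ι < A.rank) :
    ∃ w : Fin m → F, ∀ c : ι → F, A *ᵥ w ≠ (A * P) *ᵥ c := by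
  by_contra! hc
  have hle : LinearMap.range A.mulVecLin ≤ LinearMap.range (A * P).mulVecLin := by
    rintro _ ⟨w, rfl⟩
    obtain ⟨c, hc⟩ := hc w
    exact ⟨c, hc.symm⟩
  have h1 : A.rank ≤ (A * P).rank := Submodule.finrank_mono hle
  exact absurd ((h.trans_le h1).trans_le (Matrix.rank_le_card_width _)) (lt_irrefl _)

theorem exists_covector {P : Matrix (Fin m) ι F} {Q : Matrix ι (Fin n) F} (hQ : Q * A * P = 1)
    {w : Fin m → F} (hw : ∀ c : ι → F, A *ᵥ w ≠ (A * P) *ᵥ c) :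
    ∃ φ : Fin n → F, φ ᵥ* (A * P) = 0 ∧ φ ⬝ᵥ (A *ᵥ w) = 1 := by
  -- The kernel of the projection 1 − APQ is the column space of AP, so Aw survives it; a nonzero
  -- coordinate of the image, rescaled, gives φ.
  have hne : (1 - A * P * Q) *ᵥ (A *ᵥ w) ≠ 0 := by
    intro h0
    rw [Matrix.sub_mulVec, Matrix.one_mulVec, sub_eq_zero, ← Matrix.mulVec_mulVec] at h0
    exact hw _ h0
  obtain ⟨i, hi⟩ := Function.ne_iff.mp hne
  refine ⟨(Pi.single i (((1 - A * P * Q) *ᵥ (A *ᵥ w)) i)⁻¹) ᵥ* (1 - A * P * Q), ?_, ?_⟩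
  · rw [Matrix.vecMul_vecMul]
    have : (1 - A * P * Q) * (A * P) = 0 := by
      rw [Matrix.sub_mul, Matrix.one_mul, Matrix.mul_assoc (A * P) Q, ← Matrix.mul_assoc Q, hQ,
        Matrix.mul_one, sub_self]
    rw [this, Matrix.vecMul_zero]
  · rw [← Matrix.dotProduct_mulVec, single_dotProduct]
    exact inv_mul_cancel₀ hi

/-- The new frame is P plus a rank-one matrix with column w − P_k. A covector killing AP and equal
to 1 on A(w − P_k) corrects the dual Q for the new frame without spoiling its duality with P. -/
theorem frameLinked_updateCol {P : Matrix (Fin m) ι F} (hP : IsColFrame A P) (k : ι)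
    {w : Fin m → F} (hw : ∀ c : ι → F, A *ᵥ w ≠ (A * P) *ᵥ c) :
    FrameLinked A P (P.updateCol k w) := by
  obtain ⟨Q, hQ⟩ := hP
  have hd : ∀ c : ι → F, A *ᵥ (w - P.col k) ≠ (A * P) *ᵥ c := by
    intro c hc
    apply hw (c + Pi.single k 1)
    rw [Matrix.mulVec_add, ← hc, Matrix.mulVec_single_one, Matrix.mulVec_sub]
    have : (A * P).col k = A *ᵥ P.col k := rfl
    rw [this, sub_add_cancel]
  obtain ⟨φ, h₁, h₂⟩ := exists_covector hQ hd
  have hup : P.updateCol k w = P + Matrix.vecMulVec (w - P.col k) (Pi.single k 1) := by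
    ext i j
    by_cases hj : j = k
    · subst hj; simp [Matrix.vecMulVec_apply]
    · simp [Matrix.vecMulVec_apply, hj]
  have h1 : (Q - Matrix.vecMulVec ((Q * A) *ᵥ (w - P.col k)) φ) * A * P = 1 := by
    rw [Matrix.sub_mul, Matrix.sub_mul, hQ, Matrix.mul_assoc, Matrix.vecMulVec_mul, h₁,
      Matrix.vecMulVec_zero, sub_zero]
  refine ⟨_, h1, ?_⟩
  rw [hup, Matrix.mul_add, h1, Matrix.mul_vecMulVec, ← Matrix.mulVec_mulVec, Matrix.sub_mulVec,
    Matrix.vecMulVec_mulVec, h₂, ← Matrix.mulVec_mulVec]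
  simp

omit [Fintype ι] in
theorem IsColFrame.of_linked {P P' : Matrix (Fin m) ι F} (h : FrameLinked A P P') :
    IsColFrame A P' := by
  obtain ⟨Q, -, h⟩ := h
  exact ⟨Q, h⟩

/-- Steinitz exchange: columns in S are settled, the others may be sacrificed. -/
theorem exists_frame_agreeing_on (h : Fintype.card ι < A.rank) {P P' : Matrix (Fin m) ι F}
    (hP : IsColFrame A P) (hP' : IsColFrame A P') (S : Finset ι) :
    ∃ P₁ : Matrix (Fin m) ι F, IsColFrame A P₁ ∧ Relation.ReflTransGen (FrameLinked A) P P₁ ∧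
      ∀ i ∈ S, P₁.col i = P'.col i := by
  induction S using Finset.induction_on with
  | empty => exact ⟨P, hP, .refl, by simp⟩
  | insert k S hk ih =>
    obtain ⟨P₁, hP₁, hlink, hS⟩ := ih
    by_cases hx : ∃ c, A *ᵥ (P'.col k) = (A * P₁) *ᵥ c
    · obtain ⟨c, hc⟩ := hx
      -- If c were supported on S, then AP'_k would be a combination of the AP'_j with j ∈ S,
      -- against the independence of these columns as k ∉ S.
      obtain ⟨j, hj, hcj⟩ : ∃ j, j ∉ S ∧ c j ≠ 0 := by
        by_contra! h0
        obtain ⟨Q', hQ'⟩ := hP'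
        have e : (A * P₁) *ᵥ c = (A * P') *ᵥ c := by
          rw [← Matrix.mulVec_mulVec, ← Matrix.mulVec_mulVec]
          congr 1
          ext i
          refine Finset.sum_congr rfl fun j _ => ?_
          by_cases hj : j ∈ S
          · exact congrArg (· * c j) (congrFun (hS j hj) i)
          · rw [h0 j hj, mul_zero, mul_zero]
        have e2 : (Pi.single k 1 : ι → F) = c := by
          have := congrArg (Q' *ᵥ ·) (hc.trans e)
          rw [← Matrix.mulVec_single_one P' k] at this
          simpa only [Matrix.mulVec_mulVec, ← Matrix.mul_assoc, hQ', Matrix.one_mulVec] using this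
        have := h0 k hk
        rw [← e2, Pi.single_eq_same] at this
        exact one_ne_zero this
      -- Column j gives way to a spare vector w; as c j ≠ 0, this moves AP'_k out of the column
      -- space, and column k can then be replaced.
      obtain ⟨w, hw⟩ := exists_mulVec_notMem_range P₁ h
      have l₁ := frameLinked_updateCol hP₁ j hw
      have hP₂ := IsColFrame.of_linked l₁
      have hx : ∀ b : ι → F, A *ᵥ (P'.col k) ≠ (A * P₁.updateCol j w) *ᵥ b := by
        intro b hb
        have hup : P₁.updateCol j w *ᵥ b = P₁ *ᵥ (Function.update b j 0) + b j • w := by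
          ext i
          simp only [Matrix.mulVec, dotProduct, Pi.add_apply, Pi.smul_apply, smul_eq_mul]
          rw [← Finset.add_sum_erase _ _ (Finset.mem_univ j),
            ← Finset.add_sum_erase _ (fun x => P₁ i x * Function.update b j 0 x)
              (Finset.mem_univ j)]
          have : ∀ x ∈ Finset.univ.erase j, P₁.updateCol j w i x * b x =
              P₁ i x * Function.update b j 0 x := by
            intro x hx
            have hxj := Finset.ne_of_mem_erase hx
            simp [hxj]
          rw [Finset.sum_congr rfl this]
          simp
          ring
        rw [hc, ← Matrix.mulVec_mulVec b, hup, Matrix.mulVec_add, Matrix.mulVec_smul,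
          Matrix.mulVec_mulVec] at hb
        by_cases hbj : b j = 0
        · rw [hbj, zero_smul, add_zero] at hb
          obtain ⟨Q₁, hQ₁⟩ := hP₁
          have := congrArg (Q₁ *ᵥ ·) hb
          simp only [Matrix.mulVec_mulVec, ← Matrix.mul_assoc, hQ₁, Matrix.one_mulVec] at this
          rw [this, Function.update_self] at hcj
          exact hcj rfl
        · apply hw ((b j)⁻¹ • (c - Function.update b j 0))
          rw [Matrix.mulVec_smul, Matrix.mulVec_sub, hb, add_sub_cancel_left, smul_smul,
            inv_mul_cancel₀ hbj, one_smul]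
      have l₂ := frameLinked_updateCol hP₂ k hx
      refine ⟨_, IsColFrame.of_linked l₂, (hlink.tail l₁).tail l₂, ?_⟩
      intro i hi
      ext a
      rcases Finset.mem_insert.mp hi with rfl | hi
      · simp
      · have hik : i ≠ k := fun e => hk (e ▸ hi)
        have hij : i ≠ j := fun e => hj (e ▸ hi)
        simpa [hik, hij] using congrFun (hS i hi) a
    · push Not at hx
      have l₂ := frameLinked_updateCol hP₁ k hx
      refine ⟨_, IsColFrame.of_linked l₂, hlink.tail l₂, ?_⟩
      intro i hi
      ext a
      rcases Finset.mem_insert.mp hi with rfl | hi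
      · simp
      · have hik : i ≠ k := fun e => hk (e ▸ hi)
        simpa [hik] using congrFun (hS i hi) a

theorem reflTransGen_frameLinked (h : Fintype.card ι < A.rank) {P P' : Matrix (Fin m) ι F}
    (hP : IsColFrame A P) (hP' : IsColFrame A P') :
    Relation.ReflTransGen (FrameLinked A) P P' := by
  obtain ⟨P₁, -, hlink, hS⟩ := exists_frame_agreeing_on h hP hP' Finset.univ
  have : P₁ = P' := by
    ext i j
    exact congrFun (hS j (Finset.mem_univ j)) i
  exact this ▸ hlink

end IdempotentGeneration

/-! ### Generation of the ideals by idempotents -/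

section IdempotentGenerationOfIdeals

open Matrix

variable {F : Type u} [Field F] {m n : ℕ} {A : Matrix (Fin n) (Fin m) F}
  {ι : Type*} [Fintype ι] [DecidableEq ι]

theorem isIdempotentElem_frameMul_iff {P : Matrix (Fin m) ι F} {Q : Matrix ι (Fin n) F}
    (hP : IsColFrame A P) (hQ : IsRowFrame A Q) :
    IsIdempotentElem (frameMul hP hQ 1) ↔ Q * A * P = 1 := by
  constructor
  · intro h
    have h' := congrArg (fun X : regSandwich A => X.1.toMatrix) h
    simp only [regSandwich_toMatrix_mul, frameMul_toMatrix, Matrix.mul_one] at h'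
    apply hP.mul_left_cancel
    apply hQ.mul_right_cancel
    rw [Matrix.mul_one, ← h']
    simp only [Matrix.mul_assoc]
  · intro h
    apply regSandwich_ext
    rw [regSandwich_toMatrix_mul, frameMul_toMatrix, Matrix.mul_one]
    calc P * Q * A * (P * Q) = P * (Q * A * P) * Q := by simp only [Matrix.mul_assoc]
      _ = P * Q := by rw [h, Matrix.mul_one]

/-- Induction along a path of linked frames from P to a frame dual to Q: each step splits off an
idempotent PQ₁ on the left. -/
theorem frameMul_mem_of_dual_mem (hA : Fintype.card ι < A.rank)
    {T : Subsemigroup (regSandwich A)}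
    (hT : ∀ (P : Matrix (Fin m) ι F) (Q : Matrix ι (Fin n) F) (h : Q * A * P = 1),
      frameMul (isColFrame_of_dual h) (isRowFrame_of_dual h) 1 ∈ T)
    {P : Matrix (Fin m) ι F} {Q : Matrix ι (Fin n) F} (hP : IsColFrame A P)
    (hQ : IsRowFrame A Q) : frameMul hP hQ 1 ∈ T := by
  obtain ⟨P', h'⟩ := id hQ
  have hlink := reflTransGen_frameLinked hA hP (isColFrame_of_dual h')
  induction hlink using Relation.ReflTransGen.head_induction_on with
  | refl => exact hT _ _ h'
  | head hl _ ih =>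
    obtain ⟨Q₁, h₁, h₂⟩ := hl
    have := T.mul_mem (hT _ _ h₁) (ih (isColFrame_of_dual h₂))
    convert this using 1
    apply regSandwich_ext
    simp only [regSandwich_toMatrix_mul, frameMul_toMatrix, Matrix.mul_one]
    rename_i P P₁ _
    calc P * Q = P * (Q₁ * A * P₁) * Q := by rw [h₂, Matrix.mul_one]
      _ = _ := by simp only [Matrix.mul_assoc]

/-- The conditions say that adjoining v to P and φ to Q gives a dual pair with one more column and
row. -/
theorem exists_dual_extension {P : Matrix (Fin m) ι F} {Q : Matrix ι (Fin n) F}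
    (h : Q * A * P = 1) (hA : Fintype.card ι < A.rank) :
    ∃ (v : Matrix (Fin m) Unit F) (φ : Matrix Unit (Fin n) F),
      Q * A * v = 0 ∧ φ * A * P = 0 ∧ φ * A * v = 1 := by
  obtain ⟨w, hw⟩ := exists_mulVec_notMem_range P hA
  obtain ⟨φ, h₁, h₂⟩ := exists_covector h hw
  have e₁ : Matrix.replicateRow Unit φ * A * P = 0 := by
    rw [Matrix.mul_assoc, ← Matrix.replicateRow_vecMul, h₁]
    rfl
  have e₂ : Matrix.replicateRow Unit φ * A * Matrix.replicateCol Unit w = 1 := by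
    rw [Matrix.mul_assoc, ← Matrix.replicateCol_mulVec]
    ext i j
    simpa [Matrix.mul_apply, dotProduct] using h₂
  -- The factor 1 − PQA moves w into the kernel of QA; since φAP = 0, it does not change φAw.
  refine ⟨(1 - P * Q * A) * Matrix.replicateCol Unit w, Matrix.replicateRow Unit φ, ?_, e₁, ?_⟩
  · have : Q * A * (1 - P * Q * A) = 0 := by
      rw [Matrix.mul_sub, Matrix.mul_one, sub_eq_zero]
      calc Q * A = (Q * A * P) * (Q * A) := by rw [h, Matrix.one_mul]
        _ = _ := by simp only [Matrix.mul_assoc]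
    rw [← Matrix.mul_assoc, this, Matrix.zero_mul]
  · rw [Matrix.sub_mul, Matrix.one_mul, Matrix.mul_sub, e₂]
    have : Matrix.replicateRow Unit φ * A * (P * Q * A * Matrix.replicateCol Unit w) =
        (Matrix.replicateRow Unit φ * A * P) * (Q * A * Matrix.replicateCol Unit w) := by
      simp only [Matrix.mul_assoc]
    rw [this, e₁, Matrix.zero_mul, sub_zero]

omit [Fintype ι] [DecidableEq ι] in
theorem fromRows_mul_mul_fromCols {κ μ ν : Type*}
    (Q : Matrix ι (Fin n) F) (φ : Matrix κ (Fin n) F) (P : Matrix (Fin m) μ F)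
    (v : Matrix (Fin m) ν F) :
    Matrix.fromRows Q φ * A * Matrix.fromCols P v =
      Matrix.fromBlocks (Q * A * P) (Q * A * v) (φ * A * P) (φ * A * v) := by
  rw [Matrix.fromRows_mul, Matrix.fromRows_mul_fromCols]

/-- Enlarge both factors by one dimension, with the new row φ' of the first and the new column v''
of the second orthogonal under A. The middle product is then diag(1, 0), and only PQ remains. -/
theorem exists_mul_eq_of_rank_add_two_le (X : regSandwich A)
    (h : X.1.toMatrix.rank + 2 ≤ A.rank) :
    ∃ X₁ X₂ : regSandwich A, X = X₁ * X₂ ∧ X₁.1.toMatrix.rank = X.1.toMatrix.rank + 1 ∧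
      X₂.1.toMatrix.rank = X.1.toMatrix.rank + 1 := by
  obtain ⟨t, ht⟩ : ∃ t, X.1.toMatrix.rank = t := ⟨_, rfl⟩
  obtain ⟨P, Q, ⟨Q₀, h₀⟩, ⟨P₀, h₁⟩, hX⟩ := exists_frames X ht
  rw [ht] at h ⊢
  obtain ⟨v, φ, a₁, a₂, a₃⟩ := exists_dual_extension h₀ (by rw [Fintype.card_fin]; omega)
  obtain ⟨v', φ', b₁, b₂, b₃⟩ := exists_dual_extension h₁ (by rw [Fintype.card_fin]; omega)
  have ha : fromRows Q₀ φ * A * fromCols P v = 1 := by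
    rw [fromRows_mul_mul_fromCols, h₀, a₁, a₂, a₃, fromBlocks_one]
  have hb : fromRows Q φ' * A * fromCols P₀ v' = 1 := by
    rw [fromRows_mul_mul_fromCols, h₁, b₁, b₂, b₃, fromBlocks_one]
  -- Extending the pair (Q, P₀) a second time makes v'' orthogonal to φ' as well as to Q; this needs
  -- the second spare dimension.
  obtain ⟨v'', φ'', c₁, c₂, c₃⟩ := exists_dual_extension hb (by
    rw [Fintype.card_sum, Fintype.card_fin, Fintype.card_unit]; omega)
  have c₁' : Q * A * v'' = 0 ∧ φ' * A * v'' = 0 := by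
    rw [Matrix.fromRows_mul, Matrix.fromRows_mul] at c₁
    exact ⟨congrArg Matrix.toRows₁ c₁, congrArg Matrix.toRows₂ c₁⟩
  have c₂' : φ'' * A * P₀ = 0 := by
    rw [Matrix.mul_fromCols] at c₂
    exact congrArg Matrix.toCols₁ c₂
  have hc : fromRows Q φ'' * A * fromCols P₀ v'' = 1 := by
    rw [fromRows_mul_mul_fromCols, h₁, c₁'.1, c₂', c₃, fromBlocks_one]
  have hP₁ := isColFrame_of_dual ha
  have hQ₁ := isRowFrame_of_dual hb
  have hP₂ := isColFrame_of_dual hc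
  have hQ₂ := isRowFrame_of_dual hc
  refine ⟨frameMul hP₁ hQ₁ 1, frameMul hP₂ hQ₂ 1, regSandwich_ext ?_, ?_, ?_⟩
  · rw [regSandwich_toMatrix_mul, frameMul_toMatrix, frameMul_toMatrix, Matrix.mul_one,
      Matrix.mul_one, hX]
    calc P * Q = fromCols P v * fromBlocks (1 : Matrix (Fin t) (Fin t) F) 0 0
          (0 : Matrix Unit Unit F) *
          fromRows Q φ'' := by
          rw [Matrix.fromCols_mul_fromBlocks, Matrix.fromCols_mul_fromRows]
          simp
      _ = fromCols P v * (fromRows Q φ' * A * fromCols P₀ v'') * fromRows Q φ'' := by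
          rw [fromRows_mul_mul_fromCols, h₁, c₁'.1, b₂, c₁'.2]
      _ = _ := by simp only [Matrix.mul_assoc]
  · rw [frameMul_toMatrix, Matrix.mul_one, rank_frame_mul hP₁ hQ₁]
    simp
  · rw [frameMul_toMatrix, Matrix.mul_one, rank_frame_mul hP₂ hQ₂]
    simp

/-- Induction on s − rank X: a rank t < s < rank A satisfies t + 2 ≤ rank A. -/
theorem mem_of_rank_le {s : ℕ} (hs : s < A.rank) {T : Subsemigroup (regSandwich A)}
    (hT : ∀ X : regSandwich A, X.1.toMatrix.rank = s → X ∈ T) (X : regSandwich A)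
    (hX : X.1.toMatrix.rank ≤ s) : X ∈ T := by
  obtain ⟨d, hd⟩ := Nat.exists_eq_add_of_le hX
  induction d generalizing X with
  | zero => exact hT X hd.symm
  | succ d ih =>
    obtain ⟨X₁, X₂, rfl, h₁, h₂⟩ := exists_mul_eq_of_rank_add_two_le X (by omega)
    exact T.mul_mem (ih X₁ (by omega) (by omega)) (ih X₂ (by omega) (by omega))

theorem rank_frameMul_one {P : Matrix (Fin m) ι F} {Q : Matrix ι (Fin n) F}
    (hP : IsColFrame A P) (hQ : IsRowFrame A Q) :
    (frameMul hP hQ 1).1.toMatrix.rank = Fintype.card ι := by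
  rw [frameMul_toMatrix, Matrix.mul_one, rank_frame_mul hP hQ]

/-- A subsemigroup containing the idempotents of rank `s` contains every element of rank at
most `s`, if `s` is less than the rank of the sandwich matrix. -/
theorem mem_of_idempotents_mem {s : ℕ} (hs : s < A.rank) {T : Subsemigroup (regSandwich A)}
    (hT : ∀ (P : Matrix (Fin m) (Fin s) F) (Q : Matrix (Fin s) (Fin n) F) (h : Q * A * P = 1),
      frameMul (isColFrame_of_dual h) (isRowFrame_of_dual h) 1 ∈ T) (X : regSandwich A)
    (hX : X.1.toMatrix.rank ≤ s) : X ∈ T := by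
  refine mem_of_rank_le hs (fun Y hY => ?_) X hX
  obtain ⟨P, Q, hP, hQ, hY'⟩ := exists_frames Y hY
  rw [show Y = frameMul hP hQ 1 from
    regSandwich_ext (by rw [hY', frameMul_toMatrix, Matrix.mul_one])]
  exact frameMul_mem_of_dual_mem (by rwa [Fintype.card_fin]) hT hP hQ

end IdempotentGenerationOfIdeals

/-! ### Hall's theorem and alternating chains -/

section BipartiteGraphs

/-- Alternating chains: the pairs obtained from `Γ` by repeatedly joining `(u, w)` and `(u', w')`
whenever `w` is related to `u'`. -/
inductive AltChain {U W : Type*} (r : U → W → Prop) (Γ : U → W → Prop) : U → W → Prop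
  | base {u w} : Γ u w → AltChain r Γ u w
  | join {u w u' w'} : AltChain r Γ u w → r u' w → AltChain r Γ u' w' → AltChain r Γ u w'

theorem AltChain.swap {U W : Type*} {r Γ : U → W → Prop} {u : U} {w : W}
    (h : AltChain (fun w u => r u w) (fun w u => Γ u w) w u) : AltChain r Γ u w := by
  induction h with
  | base h => exact .base h
  | join _ hr _ ih₁ ih₂ => exact .join ih₂ hr ih₁

variable {U W : Type*} [Fintype U] [Fintype W] {r : U → W → Prop}

open Classical in
/-- In a connected bipartite graph, all of whose vertices on the left have degree `d` and all of
whose vertices on the right have degree `k * d`, there is a map from left to right along the edges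
through whose graph all pairs of vertices are joined by alternating chains. -/
theorem exists_map_altChain {d k : ℕ} (hd : 0 < d) (hk : 0 < k)
    (hU : ∀ u, Fintype.card {w // r u w} = d) (hW : ∀ w, Fintype.card {u // r u w} = k * d)
    (hconn : ∀ X : Set U, X.Nonempty → (∀ u ∈ X, ∀ w, r u w → ∀ u', r u' w → u' ∈ X) →
      X = Set.univ) :
    ∃ f : U → W, (∀ u, r u (f u)) ∧ ∀ u w, AltChain r (fun u w => f u = w) u w := by
  have hU' : ∀ u, (Finset.univ.filter (fun w => r u w)).card = d := fun u => by
    rw [← hU u, Fintype.card_subtype]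
  have hW' : ∀ w, (Finset.univ.filter (fun u => r u w)).card = k * d := fun w => by
    rw [← hW w, Fintype.card_subtype]
  have hcard : Fintype.card U * d = Fintype.card W * (k * d) := by
    have := Finset.sum_card_bipartiteAbove_eq_sum_card_bipartiteBelow (s := (Finset.univ : Finset U))
      (t := (Finset.univ : Finset W)) r
    simpa only [Finset.bipartiteAbove, Finset.bipartiteBelow, hU', hW', Finset.sum_const,
      smul_eq_mul, Finset.card_univ] using this
  -- With k copies of each right vertex, all degrees equal k * d, so Hall's condition holds by
  -- double counting. By `hcard` the injection is a bijection, so u ↦ (g u).1 has fibres of size k.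
  obtain ⟨g, hg, hgr⟩ : ∃ g : U → W × Fin k, Function.Injective g ∧ ∀ u, r u (g u).1 := by
    refine (Fintype.all_card_le_filter_rel_iff_exists_injective
      (fun u (p : W × Fin k) => r u p.1)).1 fun S => ?_
    have h1 := Finset.card_mul_le_card_mul (s := S)
      (t := Finset.univ.filter fun p : W × Fin k => ∃ a ∈ S, r a p.1)
      (fun u (p : W × Fin k) => r u p.1) (m := k * d) (n := k * d) ?_ ?_
    · exact Nat.le_of_mul_le_mul_right h1 (Nat.mul_pos hk hd)
    · intro u hu
      have : Finset.bipartiteAbove (fun u (p : W × Fin k) => r u p.1)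
          (Finset.univ.filter fun p : W × Fin k => ∃ a ∈ S, r a p.1) u =
          (Finset.univ.filter (fun w => r u w)) ×ˢ (Finset.univ : Finset (Fin k)) := by
        ext p
        simp only [Finset.bipartiteAbove, Finset.mem_filter, Finset.mem_univ, true_and,
          Finset.mem_product, and_true]
        exact ⟨fun h => h.2, fun h => ⟨⟨u, hu, h⟩, h⟩⟩
      rw [this, Finset.card_product, hU', Finset.card_univ, Fintype.card_fin, mul_comm]
    · intro p _
      rw [← hW' p.1]
      exact Finset.card_le_card (Finset.filter_subset_filter _ (Finset.subset_univ _))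
  have hbij : Function.Bijective g := by
    rw [Fintype.bijective_iff_injective_and_card]
    refine ⟨hg, ?_⟩
    rw [Fintype.card_prod, Fintype.card_fin]
    exact Nat.eq_of_mul_eq_mul_right hd (hcard.trans (mul_assoc _ _ _).symm)
  refine ⟨fun u => (g u).1, hgr, fun u w => ?_⟩
  -- X collects the left vertices whose image is reachable from u, and Y below is its image. All
  -- neighbours of Y lie in X.
  let X : Set U := {u' | AltChain r (fun u w => (g u).1 = w) u (g u').1}
  have hN : ∀ u₁ ∈ X, ∀ u₂, r u₂ (g u₁).1 → u₂ ∈ X := fun u₁ h₁ u₂ h₂ => .join h₁ h₂ (.base rfl)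
  let X' : Finset U := Finset.univ.filter (· ∈ X)
  let Y : Finset W := X'.image fun u => (g u).1
  have hXY : X'.card ≤ k * Y.card := by
    have : X'.card ≤ (Y ×ˢ (Finset.univ : Finset (Fin k))).card := by
      refine Finset.card_le_card_of_injOn g (fun u hu => ?_) hg.injOn
      exact Finset.mem_coe.2 (Finset.mem_product.2
        ⟨Finset.mem_image_of_mem _ hu, Finset.mem_univ _⟩)
    rwa [Finset.card_product, Finset.card_univ, Fintype.card_fin, mul_comm] at this
  have hbelow : ∀ w ∈ Y, (Finset.bipartiteBelow r X' w).card = k * d := by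
    intro w hw
    rw [← hW' w]
    congr 1
    ext u'
    simp only [Finset.bipartiteBelow, Finset.mem_filter, Finset.mem_univ, true_and, X',
      and_iff_right_iff_imp]
    obtain ⟨u₁, hu₁, rfl⟩ := Finset.mem_image.1 hw
    exact hN u₁ (Finset.mem_filter.1 hu₁).2 u'
  have hsub : ∀ u, Finset.bipartiteAbove r Y u ⊆ Finset.univ.filter (fun w => r u w) :=
    fun u => Finset.filter_subset_filter _ (Finset.subset_univ _)
  have hle : ∀ u ∈ X', (Finset.bipartiteAbove r Y u).card ≤ d := fun u _ =>
    (Finset.card_le_card (hsub u)).trans_eq (hU' u)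
  have hsum := Finset.sum_card_bipartiteAbove_eq_sum_card_bipartiteBelow (s := X') (t := Y) r
  rw [Finset.sum_congr rfl hbelow, Finset.sum_const, smul_eq_mul] at hsum
  -- Y receives k * d * |Y| ≥ d * |X| edges from X, while X emits at most d * |X|. Equality forces
  -- every neighbour of X into Y, so X is closed in the sense of `hconn`.
  have heq : ∀ u ∈ X', (Finset.bipartiteAbove r Y u).card = d := by
    refine (Finset.sum_eq_sum_iff_of_le hle).1 (le_antisymm (Finset.sum_le_sum hle) ?_)
    rw [hsum, Finset.sum_const, smul_eq_mul]
    calc X'.card * d ≤ k * Y.card * d := Nat.mul_le_mul_right _ hXY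
      _ = _ := by ring
  have hfull : ∀ u ∈ X, ∀ w, r u w → w ∈ Y := by
    intro u hu w hw
    have := Finset.eq_of_subset_of_card_le (hsub u)
      (by rw [heq u (Finset.mem_filter.2 ⟨Finset.mem_univ _, hu⟩), hU'])
    have hmem : w ∈ Finset.bipartiteAbove r Y u := by
      rw [this]; exact Finset.mem_filter.2 ⟨Finset.mem_univ _, hw⟩
    exact (Finset.mem_filter.1 hmem).1
  have huniv : X = Set.univ := by
    refine hconn X ⟨u, .base rfl⟩ fun u₁ h₁ w hw u₂ h₂ => ?_
    obtain ⟨u₃, h₃, rfl⟩ := Finset.mem_image.1 (hfull u₁ h₁ w hw)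
    exact hN u₃ (Finset.mem_filter.1 h₃).2 u₂ h₂
  obtain ⟨u', hu'⟩ := hbij.surjective (w, ⟨0, hk⟩)
  have h : AltChain r (fun u w => (g u).1 = w) u (g u').1 :=
    show u' ∈ X from huniv ▸ Set.mem_univ u'
  rwa [hu'] at h

end BipartiteGraphs

/-! ### The bipartite graph of R-classes and L-classes -/

section FrameClasses

open Matrix

variable {F : Type u} [Field F] {m n s : ℕ}

/-- Column frames up to a change of basis, i.e. the `R`-classes of regular elements of rank `s`. -/
def frameSetoid (A : Matrix (Fin n) (Fin m) F) (s : ℕ) :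
    Setoid {P : Matrix (Fin m) (Fin s) F // IsColFrame A P} where
  r P P' := ∃ g : (Matrix (Fin s) (Fin s) F)ˣ, P'.1 = P.1 * g.1
  iseqv :=
    ⟨fun P => ⟨1, (Matrix.mul_one _).symm⟩,
     fun {P P'} ⟨g, hg⟩ => ⟨g⁻¹, by rw [hg, Matrix.mul_assoc, Units.mul_inv, Matrix.mul_one]⟩,
     fun {P P' P''} ⟨g, hg⟩ ⟨h, hh⟩ => ⟨g * h, by rw [hh, hg, Units.val_mul, Matrix.mul_assoc]⟩⟩

/-- The quotient of the column frames of size `s` by changes of basis. -/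
abbrev FrameClass (A : Matrix (Fin n) (Fin m) F) (s : ℕ) : Type u := Quotient (frameSetoid A s)

variable {A : Matrix (Fin n) (Fin m) F} {B : Matrix (Fin m) (Fin n) F}

/-- The class of a column frame. -/
def frameClass {P : Matrix (Fin m) (Fin s) F} (hP : IsColFrame A P) : FrameClass A s :=
  Quotient.mk (frameSetoid A s) ⟨P, hP⟩

theorem frameClass_eq_iff {P P' : Matrix (Fin m) (Fin s) F} (hP : IsColFrame A P)
    (hP' : IsColFrame A P') :
    frameClass hP = frameClass hP' ↔ ∃ g : (Matrix (Fin s) (Fin s) F)ˣ, P' = P * g.1 :=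
  Quotient.eq (r := frameSetoid A s)

theorem exists_frameClass_eq (u : FrameClass A s) :
    ∃ (P : Matrix (Fin m) (Fin s) F) (hP : IsColFrame A P), frameClass hP = u := by
  obtain ⟨⟨P, hP⟩, rfl⟩ := Quotient.exists_rep u
  exact ⟨P, hP, rfl⟩

/-- Carrying the transpose as a variable B allows A and B to exchange roles, and B to be another
`matrixJ`. -/
theorem isColFrame_transpose_iff (hAB : Aᵀ = B) {Q : Matrix (Fin s) (Fin n) F} :
    IsColFrame B Qᵀ ↔ IsRowFrame A Q := by
  subst hAB
  constructor
  · rintro ⟨P, h⟩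
    refine ⟨Pᵀ, ?_⟩
    have := congrArg Matrix.transpose h
    simpa [Matrix.mul_assoc] using this
  · rintro ⟨P, h⟩
    refine ⟨Pᵀ, ?_⟩
    have := congrArg Matrix.transpose h
    simpa [Matrix.mul_assoc] using this

/-- The class of a row frame of `A`, as a class of column frames of the transpose `B` of `A`. -/
def rowFrameClass (hAB : Aᵀ = B) {Q : Matrix (Fin s) (Fin n) F} (hQ : IsRowFrame A Q) :
    FrameClass B s :=
  frameClass ((isColFrame_transpose_iff hAB).2 hQ)

theorem rowFrameClass_eq_iff (hAB : Aᵀ = B) {Q Q' : Matrix (Fin s) (Fin n) F}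
    (hQ : IsRowFrame A Q) (hQ' : IsRowFrame A Q') :
    rowFrameClass hAB hQ = rowFrameClass hAB hQ' ↔
      ∃ g : (Matrix (Fin s) (Fin s) F)ˣ, Q' = g.1 * Q := by
  rw [rowFrameClass, rowFrameClass, frameClass_eq_iff]
  constructor
  · rintro ⟨g, hg⟩
    refine ⟨⟨g.1ᵀ, g⁻¹.1ᵀ, ?_, ?_⟩, ?_⟩
    · rw [← Matrix.transpose_mul, Units.inv_mul, Matrix.transpose_one]
    · rw [← Matrix.transpose_mul, Units.mul_inv, Matrix.transpose_one]
    · simpa using congrArg Matrix.transpose hg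
  · rintro ⟨g, rfl⟩
    refine ⟨⟨g.1ᵀ, g⁻¹.1ᵀ, ?_, ?_⟩, ?_⟩
    · rw [← Matrix.transpose_mul, Units.inv_mul, Matrix.transpose_one]
    · rw [← Matrix.transpose_mul, Units.mul_inv, Matrix.transpose_one]
    · exact Matrix.transpose_mul _ _

theorem exists_rowFrameClass_eq (hAB : Aᵀ = B) (w : FrameClass B s) :
    ∃ (Q : Matrix (Fin s) (Fin n) F) (hQ : IsRowFrame A Q), rowFrameClass hAB hQ = w := by
  obtain ⟨P, hP, rfl⟩ := exists_frameClass_eq w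
  exact ⟨Pᵀ, (isColFrame_transpose_iff hAB).1 hP, rfl⟩

/-- A class of column frames and a class of row frames are related if they have dual
representatives, i.e. if the corresponding `H`-class contains an idempotent. -/
def FrameRel (hAB : Aᵀ = B) (u : FrameClass A s) (w : FrameClass B s) : Prop :=
  ∃ (P : Matrix (Fin m) (Fin s) F) (Q : Matrix (Fin s) (Fin n) F) (h : Q * A * P = 1),
    frameClass (isColFrame_of_dual h) = u ∧ rowFrameClass hAB (isRowFrame_of_dual h) = w

theorem frameRel_swap (hAB : Aᵀ = B) (hBA : Bᵀ = A) {u : FrameClass A s} {w : FrameClass B s}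
    (h : FrameRel hAB u w) : FrameRel hBA w u := by
  obtain ⟨P, Q, h, rfl, rfl⟩ := h
  refine ⟨Qᵀ, Pᵀ, ?_, rfl, rfl⟩
  rw [← hAB, ← Matrix.transpose_mul, ← Matrix.transpose_mul, ← Matrix.mul_assoc, h,
    Matrix.transpose_one]

theorem frameRel_swap_iff (hAB : Aᵀ = B) (hBA : Bᵀ = A) {u : FrameClass A s}
    {w : FrameClass B s} : FrameRel hAB u w ↔ FrameRel hBA w u :=
  ⟨frameRel_swap hAB hBA, frameRel_swap hBA hAB⟩

theorem FrameRel.exists_unit {hAB : Aᵀ = B} {P : Matrix (Fin m) (Fin s) F}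
    {Q : Matrix (Fin s) (Fin n) F} {hP : IsColFrame A P} {hQ : IsRowFrame A Q}
    (h : FrameRel hAB (frameClass hP) (rowFrameClass hAB hQ)) :
    ∃ g : (Matrix (Fin s) (Fin s) F)ˣ, Q * A * P = g.1 := by
  obtain ⟨P', Q', h', hu, hw⟩ := h
  obtain ⟨g, rfl⟩ := (frameClass_eq_iff _ _).1 hu
  obtain ⟨k, rfl⟩ := (rowFrameClass_eq_iff _ _ _).1 hw
  refine ⟨k * g, ?_⟩
  calc k.1 * Q' * A * (P' * g.1) = k.1 * (Q' * A * P') * g.1 := by simp only [Matrix.mul_assoc]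
    _ = _ := by rw [h', Matrix.mul_one, Units.val_mul]

/-- Rank factorizations are unique up to GL_s: the unit is QAP₀ for a dual P₀ of Q', with inverse
Q₀AP for a dual Q₀ of P'. -/
theorem frame_mul_eq_iff {P P' : Matrix (Fin m) (Fin s) F} {Q Q' : Matrix (Fin s) (Fin n) F}
    (hP' : IsColFrame A P') (hQ' : IsRowFrame A Q')
    (h : P' * Q' = P * Q) : ∃ g : (Matrix (Fin s) (Fin s) F)ˣ, P' = P * g.1 ∧ Q = g.1 * Q' := by
  obtain ⟨Q₀, h₁⟩ := hP'
  obtain ⟨P₀, h₂⟩ := hQ'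
  have e : P' = P * (Q * A * P₀) := by
    calc P' = P' * (Q' * A * P₀) := by rw [h₂, Matrix.mul_one]
      _ = (P' * Q') * A * P₀ := by simp only [Matrix.mul_assoc]
      _ = _ := by rw [h]; simp only [Matrix.mul_assoc]
  have e₁ : (Q₀ * A * P) * (Q * A * P₀) = 1 := by
    rw [Matrix.mul_assoc (Q₀ * A), ← e, h₁]
  have e₂ : (Q * A * P₀) * (Q₀ * A * P) = 1 := mul_eq_one_comm.1 e₁
  refine ⟨⟨Q * A * P₀, Q₀ * A * P, e₂, e₁⟩, e, ?_⟩
  have e' : Q' = (Q₀ * A * P) * Q := by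
    calc Q' = (Q₀ * A * P') * Q' := by rw [h₁, Matrix.one_mul]
      _ = Q₀ * A * (P' * Q') := by simp only [Matrix.mul_assoc]
      _ = _ := by rw [h]; simp only [Matrix.mul_assoc]
  rw [e', ← Matrix.mul_assoc, e₂, Matrix.one_mul]

theorem IsColFrame.mul_unit {P : Matrix (Fin m) (Fin s) F} (hP : IsColFrame A P)
    (g : (Matrix (Fin s) (Fin s) F)ˣ) : IsColFrame A (P * g.1) := by
  obtain ⟨Q, hQ⟩ := hP
  refine ⟨g⁻¹.1 * Q, ?_⟩
  calc g⁻¹.1 * Q * A * (P * g.1) = g⁻¹.1 * (Q * A * P) * g.1 := by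
        simp only [Matrix.mul_assoc]
    _ = 1 := by rw [hQ, Matrix.mul_one, Units.inv_mul]

theorem IsRowFrame.unit_mul {Q : Matrix (Fin s) (Fin n) F} (hQ : IsRowFrame A Q)
    (g : (Matrix (Fin s) (Fin s) F)ˣ) : IsRowFrame A (g.1 * Q) := by
  obtain ⟨P, hP⟩ := hQ
  refine ⟨P * g⁻¹.1, ?_⟩
  calc g.1 * Q * A * (P * g⁻¹.1) = g.1 * (Q * A * P) * g⁻¹.1 := by
        simp only [Matrix.mul_assoc]
    _ = 1 := by rw [hP, Matrix.mul_one, Units.mul_inv]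

/-- Generation by a family of idempotents all of whose pairs of classes are joined by chains. -/
theorem mem_of_altChain [Finite F] (hAB : Aᵀ = B) (hs : s < A.rank)
    {Γ : FrameClass A s → FrameClass B s → Prop}
    (hΓ : ∀ u w, AltChain (FrameRel hAB) Γ u w) {T : Subsemigroup (regSandwich A)}
    (hT : ∀ u w, Γ u w → ∃ (P : Matrix (Fin m) (Fin s) F) (Q : Matrix (Fin s) (Fin n) F)
      (hP : IsColFrame A P) (hQ : IsRowFrame A Q), frameClass hP = u ∧
        rowFrameClass hAB hQ = w ∧ frameMul hP hQ 1 ∈ T)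
    (X : regSandwich A) (hX : X.1.toMatrix.rank ≤ s) : X ∈ T := by
  refine mem_of_idempotents_mem hs (fun P Q h => ?_) X hX
  have key : ∀ u w, AltChain (FrameRel hAB) Γ u w →
      ∃ (P : Matrix (Fin m) (Fin s) F) (Q : Matrix (Fin s) (Fin n) F)
        (hP : IsColFrame A P) (hQ : IsRowFrame A Q), frameClass hP = u ∧
        rowFrameClass hAB hQ = w ∧ frameMul hP hQ 1 ∈ T := by
    intro u w hc
    induction hc with
    | base h => exact hT _ _ h
    | join _ hr _ ih₁ ih₂ =>
      obtain ⟨P₁, Q₁, hP₁, hQ₁, rfl, rfl, h₁⟩ := ih₁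
      obtain ⟨P₂, Q₂, hP₂, hQ₂, rfl, rfl, h₂⟩ := ih₂
      -- Relatedness makes Q₁AP₂ a unit, so the product has the column class of P₁ and the row class
      -- of Q₂.
      obtain ⟨g, hg⟩ := hr.exists_unit
      refine ⟨P₁, g.1 * Q₂, hP₁, hQ₂.unit_mul g, rfl, ((rowFrameClass_eq_iff _ _ _).2 ⟨g, rfl⟩).symm, ?_⟩
      convert T.mul_mem h₁ h₂ using 1
      apply regSandwich_ext
      simp only [regSandwich_toMatrix_mul, frameMul_toMatrix, Matrix.mul_one]
      rw [← hg]
      simp only [Matrix.mul_assoc]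
  obtain ⟨P', Q', hP', hQ', hu, hw, hmem⟩ := key _ _
    (hΓ (frameClass (isColFrame_of_dual h)) (rowFrameClass hAB (isRowFrame_of_dual h)))
  obtain ⟨g, rfl⟩ := (frameClass_eq_iff _ _).1 hu.symm
  obtain ⟨k, rfl⟩ := (rowFrameClass_eq_iff _ _ _).1 hw.symm
  -- The chain only yields P(gk)Q, which lies in a group with identity PQ because QAP = 1. As F is
  -- finite, a positive power is PQ itself; exponents start at 1 because T has only products.
  have hpow : ∀ j : ℕ, frameMul (isColFrame_of_dual h) (isRowFrame_of_dual h)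
      ((g * k) ^ (j + 1)).1 ∈ T := by
    intro j
    induction j with
    | zero =>
      convert hmem using 1
      apply regSandwich_ext
      simp only [frameMul_toMatrix, Matrix.mul_one, zero_add, pow_one, Units.val_mul,
        Matrix.mul_assoc]
    | succ j ih =>
      convert T.mul_mem ih hmem using 1
      apply regSandwich_ext
      simp only [regSandwich_toMatrix_mul, frameMul_toMatrix, Matrix.mul_one]
      rw [pow_succ _ (j + 1), Units.val_mul, Units.val_mul g k]
      calc P * (((g * k) ^ (j + 1)).1 * (g.1 * k.1)) * Q
          = P * (((g * k) ^ (j + 1)).1 * 1 * (g.1 * k.1)) * Q := by rw [Matrix.mul_one]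
        _ = P * (((g * k) ^ (j + 1)).1 * (Q * A * P) * (g.1 * k.1)) * Q := by rw [h]
        _ = _ := by simp only [Matrix.mul_assoc]
  have := hpow (orderOf (g * k) - 1)
  rwa [Nat.sub_add_cancel (orderOf_pos _), pow_orderOf_eq_one] at this

/-- Linked frames have a common dual, hence their classes have a common neighbour. -/
theorem frameClass_connected (hAB : Aᵀ = B) (hs : s < A.rank) (X : Set (FrameClass A s))
    (hX : X.Nonempty)
    (hcl : ∀ u ∈ X, ∀ w, FrameRel hAB u w → ∀ u', FrameRel hAB u' w → u' ∈ X) :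
    X = Set.univ := by
  obtain ⟨u, hu⟩ := hX
  obtain ⟨P, hP, rfl⟩ := exists_frameClass_eq u
  refine Set.eq_univ_of_forall fun u' => ?_
  obtain ⟨P', hP', rfl⟩ := exists_frameClass_eq u'
  have hlink := reflTransGen_frameLinked (by rwa [Fintype.card_fin]) hP hP'
  induction hlink with
  | refl => exact hu
  | tail _ hl ih =>
    obtain ⟨Q, h₁, h₂⟩ := hl
    exact hcl _ (ih (isColFrame_of_dual h₁)) _ ⟨_, Q, h₁, rfl, rfl⟩ _ ⟨_, Q, h₂, rfl, rfl⟩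

/-- Every Q is uniquely a left inverse of H plus (M − 1)L, with M = QH an arbitrary square matrix.
-/
theorem card_left_inverses {H : Matrix (Fin n) (Fin s) F} {L : Matrix (Fin s) (Fin n) F}
    (hL : L * H = 1) :
    Nat.card {Q : Matrix (Fin s) (Fin n) F // Q * H = 1} * Nat.card F ^ (s * s) =
      Nat.card F ^ (s * n) := by
  have hcard : ∀ a b : ℕ, Nat.card (Matrix (Fin a) (Fin b) F) = Nat.card F ^ (a * b) := by
    intro a b
    rw [show Matrix (Fin a) (Fin b) F = (Fin a → Fin b → F) from rfl, Nat.card_fun, Nat.card_fun,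
      Nat.card_fin, Nat.card_fin, ← pow_mul, mul_comm]
  rw [← hcard, ← hcard, ← Nat.card_prod]
  refine Nat.card_congr
    { toFun := fun p => p.1.1 - L + p.2 * L
      invFun := fun Q => (⟨Q - Q * H * L + L, ?_⟩, Q * H)
      left_inv := ?_
      right_inv := ?_ }
  · rw [Matrix.add_mul, Matrix.sub_mul, Matrix.mul_assoc (Q * H), hL, Matrix.mul_one, sub_self,
      zero_add]
  · rintro ⟨⟨Q, hQ⟩, M⟩
    have e : (Q - L + M * L) * H = M := by
      rw [Matrix.add_mul, Matrix.sub_mul, Matrix.mul_assoc M, hL, hQ, sub_self, zero_add,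
        Matrix.mul_one]
    refine Prod.ext (Subtype.ext ?_) e
    change Q - L + M * L - (Q - L + M * L) * H * L + L = Q
    rw [e]
    abel
  · intro Q
    change Q - Q * H * L + L - L + Q * H * L = Q
    abel

/-- Each row class related to that of P contains exactly one Q with QAP = 1, so neighbours
correspond to left inverses of AP. -/
theorem card_frameRel (hAB : Aᵀ = B) (u : FrameClass A s) :
    Nat.card {w : FrameClass B s // FrameRel hAB u w} * Nat.card F ^ (s * s) =
      Nat.card F ^ (s * n) := by
  obtain ⟨P, hP, rfl⟩ := exists_frameClass_eq u
  obtain ⟨L, hL⟩ := id hP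
  rw [Matrix.mul_assoc] at hL
  rw [← card_left_inverses hL]
  congr 1
  have hd : ∀ {Q : Matrix (Fin s) (Fin n) F}, Q * (A * P) = 1 → Q * A * P = 1 := fun h => by
    rwa [Matrix.mul_assoc]
  refine (Nat.card_congr (Equiv.ofBijective
    (fun Q : {Q : Matrix (Fin s) (Fin n) F // Q * (A * P) = 1} =>
      (⟨rowFrameClass hAB (isRowFrame_of_dual (hd Q.2)), P, Q.1, hd Q.2, rfl, rfl⟩ :
        {w : FrameClass B s // FrameRel hAB (frameClass hP) w})) ⟨?_, ?_⟩)).symm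
  · rintro ⟨Q, hQ⟩ ⟨Q', hQ'⟩ h
    obtain ⟨g, hg⟩ := (rowFrameClass_eq_iff hAB (isRowFrame_of_dual (hd hQ))
      (isRowFrame_of_dual (hd hQ'))).1 (congrArg Subtype.val h)
    refine Subtype.ext ?_
    change Q = Q'
    rw [hg, Matrix.mul_assoc, hQ, Matrix.mul_one] at hQ'
    rw [hg, hQ', Matrix.one_mul]
  · rintro ⟨w, hw⟩
    obtain ⟨Q, hQ, rfl⟩ := exists_rowFrameClass_eq hAB w
    obtain ⟨g, hg⟩ := hw.exists_unit
    have e : g⁻¹.1 * Q * (A * P) = 1 := by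
      rw [Matrix.mul_assoc, ← Matrix.mul_assoc Q, hg, Units.inv_mul]
    refine ⟨⟨g⁻¹.1 * Q, e⟩, Subtype.ext ?_⟩
    refine (rowFrameClass_eq_iff hAB (isRowFrame_of_dual (hd e)) hQ).2 ⟨g, ?_⟩
    rw [← Matrix.mul_assoc, Units.mul_inv, Matrix.one_mul]

/-- GL_s acts freely on column frames, since frames can be cancelled on the left. -/
theorem card_frameClass_mul_card_units (A : Matrix (Fin n) (Fin m) F) (s : ℕ) :
    Nat.card (FrameClass A s) * Nat.card (Matrix (Fin s) (Fin s) F)ˣ =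
      Nat.card {P : Matrix (Fin m) (Fin s) F // IsColFrame A P} := by
  rw [← Nat.card_prod]
  refine Nat.card_congr (Equiv.ofBijective
    (fun p : FrameClass A s × (Matrix (Fin s) (Fin s) F)ˣ =>
      (⟨p.1.out.1 * p.2.1, p.1.out.2.mul_unit p.2⟩ :
        {P : Matrix (Fin m) (Fin s) F // IsColFrame A P})) ⟨?_, ?_⟩)
  · rintro ⟨u, g⟩ ⟨u', g'⟩ h
    have h' : u.out.1 * g.1 = u'.out.1 * g'.1 := congrArg Subtype.val h
    have hu : u = u' := by
      rw [← Quotient.out_eq u, ← Quotient.out_eq u']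
      refine Quotient.sound (s := frameSetoid A s) ⟨g * g'⁻¹, ?_⟩
      rw [Units.val_mul, ← Matrix.mul_assoc, h', Matrix.mul_assoc, Units.mul_inv, Matrix.mul_one]
    subst hu
    exact Prod.ext rfl (Units.ext (u.out.2.mul_left_cancel h'))
  · rintro ⟨P, hP⟩
    obtain ⟨g, hg⟩ : ∃ g : (Matrix (Fin s) (Fin s) F)ˣ, P = (frameClass hP).out.1 * g.1 :=
      (frameClass_eq_iff (Quotient.out (frameClass hP)).2 hP).1
        (Quotient.out_eq (frameClass hP))
    exact ⟨(frameClass hP, g), Subtype.ext hg.symm⟩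

section Counting

variable [Finite F]

instance : Finite (FrameClass A s) := by
  have : Finite (Matrix (Fin m) (Fin s) F) :=
    inferInstanceAs (Finite (Fin m → Fin s → F))
  exact Quotient.finite _

theorem exists_map_altChain_frames (hAB : Aᵀ = B) (hnm : n ≤ m) (hs : s < A.rank) :
    ∃ f : FrameClass A s → FrameClass B s, (∀ u, FrameRel hAB u (f u)) ∧
      ∀ u w, AltChain (FrameRel hAB) (fun u w => f u = w) u w := by
  classical
  have := Fintype.ofFinite (FrameClass A s)
  have := Fintype.ofFinite (FrameClass B s)
  have hBA : Bᵀ = A := by rw [← hAB, Matrix.transpose_transpose]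
  have hq : 0 < Nat.card F := Nat.card_pos
  have hsn : s ≤ n := hs.le.trans ((Matrix.rank_le_card_height A).trans_eq (Fintype.card_fin n))
  -- The degrees are q^(s(n−s)) on the left and q^(s(m−s)) on the right, with ratio k.
  refine exists_map_altChain (d := Nat.card F ^ (s * (n - s))) (k := Nat.card F ^ (s * (m - n)))
    (pow_pos hq _) (pow_pos hq _) (fun u => ?_) (fun w => ?_) (frameClass_connected hAB hs)
  · rw [← Nat.card_eq_fintype_card]
    apply Nat.eq_of_mul_eq_mul_right (pow_pos hq (s * s))
    rw [card_frameRel, ← pow_add, ← mul_add, Nat.sub_add_cancel hsn]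
  · rw [← Nat.card_eq_fintype_card]
    apply Nat.eq_of_mul_eq_mul_right (pow_pos hq (s * s))
    simp only [frameRel_swap_iff hAB hBA]
    rw [card_frameRel, ← pow_add, ← pow_add, ← mul_add, ← mul_add]
    congr 2
    omega

end Counting

end FrameClasses

/-! ### The q-binomial coefficient as a quotient of products -/

section QBinomialCount

/-- `∏_{i < k} (q ^ (i + 1) - 1) = [k]! (q - 1) ^ k`. -/
theorem qFactorial_mul_pow {q : ℕ} (hq : 1 ≤ q) (k : ℕ) :
    qFactorial q k * (q - 1) ^ k = ∏ i ∈ Finset.range k, (q ^ (i + 1) - 1) := by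
  induction k with
  | zero => simp [qFactorial]
  | succ k ih =>
    rw [Finset.prod_range_succ, ← ih, qFactorial_succ, ← geom_sum_mul_of_one_le hq]
    ring

/-- Each factor is q^i(q^(r−i) − 1); the second product supplies the missing factors with small
exponent. -/
theorem prod_pow_sub_pow_mul (q r s : ℕ) (hs : s ≤ r) :
    (∏ i ∈ Finset.range s, (q ^ r - q ^ i)) * ∏ i ∈ Finset.range (r - s), (q ^ (i + 1) - 1) =
      q ^ (∑ i ∈ Finset.range s, i) * ∏ i ∈ Finset.range r, (q ^ (i + 1) - 1) := by
  induction s with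
  | zero => simp
  | succ s ih =>
    have h := ih (by omega)
    obtain ⟨d, rfl⟩ : ∃ d, r = s + 1 + d := ⟨r - (s + 1), by omega⟩
    rw [show s + 1 + d - s = d + 1 by omega, Finset.prod_range_succ] at h
    rw [show s + 1 + d - (s + 1) = d by omega, Finset.prod_range_succ, Finset.sum_range_succ]
    have e : q ^ (s + 1 + d) - q ^ s = q ^ s * (q ^ (d + 1) - 1) := by
      rw [Nat.mul_sub, mul_one, ← pow_add]; congr 2; omega
    rw [e, pow_add q (∑ i ∈ Finset.range s, i) s]
    generalize ∏ i ∈ Finset.range s, (q ^ (s + 1 + d) - q ^ i) = a,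
      ∏ i ∈ Finset.range d, (q ^ (i + 1) - 1) = b, q ^ (d + 1) - 1 = x at *
    calc a * (q ^ s * x) * b = q ^ s * (a * (b * x)) := by ring
      _ = _ := by rw [h]; ring

theorem qBinomial_mul_prod {q : ℕ} (hq : 2 ≤ q) {r s : ℕ} (hs : s ≤ r) :
    qBinomial q r s * ∏ i ∈ Finset.range s, (q ^ s - q ^ i) =
      ∏ i ∈ Finset.range s, (q ^ r - q ^ i) := by
  have hq1 : 1 ≤ q := by omega
  have hG : 0 < ∏ i ∈ Finset.range (r - s), (q ^ (i + 1) - 1) :=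
    Finset.prod_pos fun i _ => Nat.sub_pos_of_lt (Nat.one_lt_pow (by omega) (by omega))
  apply Nat.eq_of_mul_eq_mul_right hG
  have h1 := prod_pow_sub_pow_mul q s s le_rfl
  rw [Nat.sub_self, Finset.range_zero, Finset.prod_empty, mul_one] at h1
  rw [prod_pow_sub_pow_mul q r s hs, h1, ← qFactorial_mul_pow hq1, ← qFactorial_mul_pow hq1,
    ← qFactorial_mul_pow hq1, ← qBinomial_mul q r s hs]
  obtain ⟨d, rfl⟩ := Nat.exists_eq_add_of_le hs
  rw [Nat.add_sub_cancel_left, pow_add]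
  ring

end QBinomialCount

/-! ### Counting the frames of J -/

section FramesOfJ

open Matrix

variable {F : Type u} [Field F] {m n r s : ℕ}

theorem matrixJ_transpose : (matrixJ F n m r)ᵀ = matrixJ F m n r := by
  ext i j
  simp only [matrixJ, Matrix.transpose_apply, Matrix.of_apply]
  congr 1
  apply propext
  constructor <;> rintro ⟨h, h'⟩ <;> exact ⟨h.symm, by omega⟩

theorem matrixJ_eq_mul (hm : r ≤ m) (hn : r ≤ n) :
    matrixJ F n m r = (1 : Matrix (Fin n) (Fin n) F).submatrix id (Fin.castLE hn) *
      (1 : Matrix (Fin m) (Fin m) F).submatrix (Fin.castLE hm) id := by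
  ext i j
  simp only [matrixJ, Matrix.of_apply, Matrix.mul_apply, Matrix.submatrix_apply, id,
    Matrix.one_apply, ← ite_and, mul_ite, mul_one, mul_zero]
  split_ifs with h
  · rw [Finset.sum_eq_single ⟨i, h.2⟩]
    · rw [if_pos]
      exact ⟨Fin.ext h.1, Fin.ext rfl⟩
    · intro b _ hb
      rw [if_neg]
      rintro ⟨-, hi⟩
      exact hb (Fin.ext (congrArg Fin.val hi).symm)
    · simp
  · rw [Finset.sum_eq_zero]
    intro k _
    rw [if_neg]
    rintro ⟨hj, hi⟩
    refine h ⟨?_, ?_⟩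
    · rw [hi, ← hj]; rfl
    · rw [hi]; exact k.2

theorem matrixJ_rank (hm : r ≤ m) (hn : r ≤ n) : (matrixJ F n m r).rank = r := by
  apply le_antisymm
  · rw [matrixJ_eq_mul hm hn]
    exact (Matrix.rank_mul_le_left _ _).trans
      ((Matrix.rank_le_card_width _).trans_eq (Fintype.card_fin r))
  · have h : (1 : Matrix (Fin n) (Fin n) F).submatrix (Fin.castLE hn) id * matrixJ F n m r *
        (1 : Matrix (Fin m) (Fin m) F).submatrix id (Fin.castLE hm) = 1 := by
      have e : (1 : Matrix (Fin n) (Fin n) F).submatrix (Fin.castLE hn) id * matrixJ F n m r *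
          (1 : Matrix (Fin m) (Fin m) F).submatrix id (Fin.castLE hm) =
          (matrixJ F n m r).submatrix (Fin.castLE hn) (Fin.castLE hm) := by
        ext i j
        simp [Matrix.mul_apply, Matrix.one_apply]
      rw [e]
      ext i j
      simp [matrixJ, Matrix.one_apply, Fin.ext_iff]
    simpa using card_le_rank_of_dual h

theorem linearIndependent_iff_exists_left_inverse {M : Matrix (Fin r) (Fin s) F} :
    LinearIndependent F M.col ↔ ∃ L : Matrix (Fin s) (Fin r) F, L * M = 1 := by
  rw [← Matrix.mulVec_injective_iff]
  constructor
  · intro h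
    obtain ⟨g, hg⟩ := M.toLin'.exists_leftInverse_of_injective (LinearMap.ker_eq_bot.2 h)
    refine ⟨LinearMap.toMatrix' g, ?_⟩
    apply Matrix.toLin'.injective
    rw [Matrix.toLin'_mul, Matrix.toLin'_toMatrix', hg, Matrix.toLin'_one]
  · rintro ⟨L, hL⟩ x y h
    simpa [hL] using congrArg (L *ᵥ ·) h

/-- JP consists of the first r rows of P padded with zero rows, so the remaining rows of P impose no
condition. -/
theorem isColFrame_matrixJ_iff (hm : r ≤ m) (hn : r ≤ n) {P : Matrix (Fin m) (Fin s) F} :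
    IsColFrame (matrixJ F n m r) P ↔
      LinearIndependent F (P.submatrix (Fin.castLE hm) id).col := by
  rw [linearIndependent_iff_exists_left_inverse]
  have hJP : matrixJ F n m r * P = (1 : Matrix (Fin n) (Fin n) F).submatrix id (Fin.castLE hn) *
      P.submatrix (Fin.castLE hm) id := by
    rw [matrixJ_eq_mul hm hn, Matrix.mul_assoc]
    congr 1
    ext i j
    simp [Matrix.mul_apply, Matrix.one_apply]
  constructor
  · rintro ⟨Q, hQ⟩
    rw [Matrix.mul_assoc, hJP, ← Matrix.mul_assoc] at hQ
    exact ⟨_, hQ⟩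
  · rintro ⟨L, hL⟩
    refine ⟨L * (1 : Matrix (Fin n) (Fin n) F).submatrix (Fin.castLE hn) id, ?_⟩
    have e : (1 : Matrix (Fin n) (Fin n) F).submatrix (Fin.castLE hn) id *
        (1 : Matrix (Fin n) (Fin n) F).submatrix id (Fin.castLE hn) = 1 := by
      ext i j
      simp [Matrix.mul_apply, Matrix.one_apply]
    rw [Matrix.mul_assoc, hJP, Matrix.mul_assoc, ← Matrix.mul_assoc _ _ (P.submatrix _ _), e,
      Matrix.one_mul, hL]

theorem card_linearIndependent_fin [Finite F] (hs : s ≤ r) :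
    Nat.card {v : Fin s → Fin r → F // LinearIndependent F v} =
      ∏ i ∈ Finset.range s, (Nat.card F ^ r - Nat.card F ^ i) := by
  have := Fintype.ofFinite F
  rw [card_linearIndependent (by simpa using hs), Module.finrank_fintype_fun_eq_card,
    Fintype.card_fin, Nat.card_eq_fintype_card,
    Fin.prod_univ_eq_prod_range (fun i => Fintype.card F ^ r - Fintype.card F ^ i)]

theorem card_isColFrame_matrixJ [Finite F] (hm : r ≤ m) (hn : r ≤ n) (hs : s ≤ r) :
    Nat.card {P : Matrix (Fin m) (Fin s) F // IsColFrame (matrixJ F n m r) P} =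
      (∏ i ∈ Finset.range s, (Nat.card F ^ r - Nat.card F ^ i)) *
        Nat.card F ^ (s * (m - r)) := by
  obtain ⟨c, rfl⟩ := Nat.exists_eq_add_of_le hm
  have hM : Nat.card (Matrix (Fin c) (Fin s) F) = Nat.card F ^ (s * (r + c - r)) := by
    rw [show Matrix (Fin c) (Fin s) F = (Fin c → Fin s → F) from rfl, Nat.card_fun, Nat.card_fun,
      Nat.card_fin, Nat.card_fin, ← pow_mul, Nat.add_sub_cancel_left]
  rw [← card_linearIndependent_fin hs, ← hM, ← Nat.card_prod]
  refine Nat.card_congr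
    { toFun := fun P => (⟨(P.1.submatrix (Fin.castLE hm) id).col,
        (isColFrame_matrixJ_iff hm hn).1 P.2⟩, P.1.submatrix (Fin.natAdd r) id)
      invFun := fun p => ⟨Matrix.of fun i j =>
        Fin.addCases (fun i => p.1.1 j i) (fun i => p.2 i j) i, ?_⟩
      left_inv := ?_
      right_inv := ?_ }
  · rw [isColFrame_matrixJ_iff hm hn]
    convert p.1.2 using 1
    funext j i
    exact Fin.addCases_left (motive := fun _ => F) (left := fun i => p.1.1 j i)
      (right := fun i => p.2 i j) i
  · rintro ⟨P, hP⟩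
    apply Subtype.ext
    ext i j
    induction i using Fin.addCases with
    | left i =>
      exact Fin.addCases_left (motive := fun _ => F)
        (left := fun i => P (Fin.castLE hm i) j) (right := fun i => P (Fin.natAdd r i) j) i
    | right i =>
      exact Fin.addCases_right (motive := fun _ => F)
        (left := fun i => P (Fin.castLE hm i) j) (right := fun i => P (Fin.natAdd r i) j) i
  · rintro ⟨⟨v, hv⟩, M⟩
    refine Prod.ext (Subtype.ext ?_) ?_
    · ext j i
      exact Fin.addCases_left (motive := fun _ => F)
        (left := v j) (right := fun i => M i j) i
    · ext i j
      exact Fin.addCases_right (motive := fun _ => F)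
        (left := v j) (right := fun i => M i j) i

theorem card_frameClass_matrixJ [Finite F] (hm : r ≤ m) (hn : r ≤ n) (hs : s ≤ r) :
    Nat.card (FrameClass (matrixJ F n m r) s) =
      Nat.card F ^ (s * (m - r)) * qBinomial (Nat.card F) r s := by
  have h := card_frameClass_mul_card_units (matrixJ F n m r) s
  have hU : Nat.card (Matrix (Fin s) (Fin s) F)ˣ =
      ∏ i ∈ Finset.range s, (Nat.card F ^ s - Nat.card F ^ i) := by
    have := Fintype.ofFinite F
    rw [Nat.card_eq_fintype_card (α := F), ← Fin.prod_univ_eq_prod_range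
      (fun i => Fintype.card F ^ s - Fintype.card F ^ i)]
    exact Matrix.card_GL_field s
  have hpos : 0 < Nat.card (Matrix (Fin s) (Fin s) F)ˣ := by
    have : Finite (Matrix (Fin s) (Fin s) F) := inferInstanceAs (Finite (Fin s → Fin s → F))
    exact Nat.card_pos
  apply Nat.eq_of_mul_eq_mul_right hpos
  rw [h, card_isColFrame_matrixJ hm hn hs, hU, mul_assoc,
    qBinomial_mul_prod Finite.one_lt_card hs, mul_comm]

end FramesOfJ

/-! ### Bounds on generating sets -/

section GeneratingSets

open Matrix

variable {F : Type u} [Field F] {m n s : ℕ} {A : Matrix (Fin n) (Fin m) F}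
  {B : Matrix (Fin m) (Fin n) F}

/-- Every `R`-class and every `L`-class of rank `s` meets any set whose closure contains the
elements of rank `s` and consists of elements of rank at most `s`. -/
theorem exists_frames_mem_of_closure {Ω : Set (regSandwich A)}
    (hΩ : ∀ X ∈ Subsemigroup.closure Ω, X.1.toMatrix.rank ≤ s) {X : regSandwich A}
    (hX : X ∈ Subsemigroup.closure Ω) {P : Matrix (Fin m) (Fin s) F}
    {Q : Matrix (Fin s) (Fin n) F} (hP : IsColFrame A P) (hQ : IsRowFrame A Q)
    (hXPQ : X.1.toMatrix = P * Q) :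
    (∃ ω ∈ Ω, ∃ Q' : Matrix (Fin s) (Fin n) F, IsRowFrame A Q' ∧ ω.1.toMatrix = P * Q') ∧
      ∃ ω ∈ Ω, ∃ P' : Matrix (Fin m) (Fin s) F, IsColFrame A P' ∧ ω.1.toMatrix = P' * Q := by
  induction hX using Subsemigroup.closure_induction generalizing P Q with
  | mem X hX => exact ⟨⟨X, hX, Q, hQ, hXPQ⟩, X, hX, P, hP, hXPQ⟩
  | mul X₁ X₂ h₁ h₂ ih₁ ih₂ =>
    -- A product of rank s has both factors of rank s, so it shares its R-class with X₁ and its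
    -- L-class with X₂, where induction applies.
    have hrank : (X₁ * X₂).1.toMatrix.rank = s := by
      rw [hXPQ, rank_frame_mul hP hQ, Fintype.card_fin]
    have hr₁ : X₁.1.toMatrix.rank = s := le_antisymm (hΩ _ h₁)
      (hrank.symm.le.trans (rank_mul_le_of_regSandwich X₁ X₂).1)
    have hr₂ : X₂.1.toMatrix.rank = s := le_antisymm (hΩ _ h₂)
      (hrank.symm.le.trans (rank_mul_le_of_regSandwich X₁ X₂).2)
    obtain ⟨P₁, Q₁, hP₁, hQ₁, e₁⟩ := exists_frames X₁ hr₁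
    obtain ⟨P₂, Q₂, hP₂, hQ₂, e₂⟩ := exists_frames X₂ hr₂
    rw [regSandwich_toMatrix_mul, e₁, e₂] at hXPQ
    constructor
    · have h : P * Q = P₁ * (Q₁ * A * P₂ * Q₂) := by
        rw [← hXPQ]; simp only [Matrix.mul_assoc]
      obtain ⟨g, rfl, -⟩ := frame_mul_eq_iff hP hQ h
      obtain ⟨ω, hω, Q', hQ', e⟩ := (ih₁ hP₁ hQ₁ e₁).1
      refine ⟨ω, hω, g⁻¹.1 * Q', hQ'.unit_mul g⁻¹, ?_⟩
      rw [e, Matrix.mul_assoc, ← Matrix.mul_assoc g.1, Units.mul_inv, Matrix.one_mul]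
    · have h : P * Q = (P₁ * (Q₁ * A * P₂)) * Q₂ := by
        rw [← hXPQ]; simp only [Matrix.mul_assoc]
      obtain ⟨g, -, rfl⟩ := frame_mul_eq_iff hP hQ h
      obtain ⟨ω, hω, P', hP', e⟩ := (ih₂ hP₂ hQ₂ e₂).2
      refine ⟨ω, hω, P' * g.1, hP'.mul_unit g, ?_⟩
      rw [e, Matrix.mul_assoc]

/-- A fixed dual pair completes any frame to an element of rank s, so each class contains a
generator; uniqueness of factorizations makes the choice of generator injective. -/
theorem mk_frameClass_le_of_closure_eq {T : Subsemigroup (regSandwich A)} (hs : s ≤ A.rank)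
    (hT : ∀ X, X ∈ T ↔ X.1.toMatrix.rank ≤ s) (hAB : Aᵀ = B) {Ω : Set (regSandwich A)}
    (hΩ : Subsemigroup.closure Ω = T) :
    Cardinal.mk (FrameClass A s) ≤ Cardinal.mk Ω ∧
      Cardinal.mk (FrameClass B s) ≤ Cardinal.mk Ω := by
  obtain ⟨P₀, Q₀, h₀⟩ := exists_dual_frames hs
  have hmem : ∀ {P : Matrix (Fin m) (Fin s) F} {Q : Matrix (Fin s) (Fin n) F}
      (hP : IsColFrame A P) (hQ : IsRowFrame A Q),
      frameMul hP hQ 1 ∈ Subsemigroup.closure Ω := fun hP hQ => by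
    rw [hΩ, hT, rank_frameMul_one, Fintype.card_fin]
  have hle : ∀ X ∈ Subsemigroup.closure Ω, X.1.toMatrix.rank ≤ s := fun X hX =>
    (hT X).1 (hΩ ▸ hX)
  constructor
  · have h : ∀ u : FrameClass A s, ∃ ω : Ω, ∃ (P : Matrix (Fin m) (Fin s) F)
        (Q : Matrix (Fin s) (Fin n) F) (hP : IsColFrame A P), IsRowFrame A Q ∧
        frameClass hP = u ∧ ω.1.1.toMatrix = P * Q := by
      intro u
      obtain ⟨P, hP, rfl⟩ := exists_frameClass_eq u
      obtain ⟨⟨ω, hω, Q, hQ, e⟩, -⟩ := exists_frames_mem_of_closure hle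
        (hmem hP (isRowFrame_of_dual h₀)) hP (isRowFrame_of_dual h₀)
        (by rw [frameMul_toMatrix, Matrix.mul_one])
      exact ⟨⟨ω, hω⟩, P, Q, hP, hQ, rfl, e⟩
    choose ω hω using h
    refine Cardinal.mk_le_of_injective (f := ω) fun u u' huu => ?_
    obtain ⟨P, Q, hP, hQ, rfl, e⟩ := hω u
    obtain ⟨P', Q', hP', hQ', rfl, e'⟩ := hω u'
    obtain ⟨g, hg, -⟩ := frame_mul_eq_iff hP' hQ' (e'.symm.trans (huu ▸ e))
    exact (frameClass_eq_iff _ _).2 ⟨g, hg⟩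
  · have h : ∀ w : FrameClass B s, ∃ ω : Ω, ∃ (P : Matrix (Fin m) (Fin s) F)
        (Q : Matrix (Fin s) (Fin n) F) (hQ : IsRowFrame A Q), IsColFrame A P ∧
        rowFrameClass hAB hQ = w ∧ ω.1.1.toMatrix = P * Q := by
      intro w
      obtain ⟨Q, hQ, rfl⟩ := exists_rowFrameClass_eq hAB w
      obtain ⟨-, ω, hω, P, hP, e⟩ := exists_frames_mem_of_closure hle
        (hmem (isColFrame_of_dual h₀) hQ) (isColFrame_of_dual h₀) hQ
        (by rw [frameMul_toMatrix, Matrix.mul_one])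
      exact ⟨⟨ω, hω⟩, P, Q, hQ, hP, rfl, e⟩
    choose ω hω using h
    refine Cardinal.mk_le_of_injective (f := ω) fun w w' hww => ?_
    obtain ⟨P, Q, hQ, hP, rfl, e⟩ := hω w
    obtain ⟨P', Q', hQ', hP', rfl, e'⟩ := hω w'
    obtain ⟨g, -, hg⟩ := frame_mul_eq_iff hP hQ (e.symm.trans (hww ▸ e'))
    exact (rowFrameClass_eq_iff _ _ _).2 ⟨g, hg⟩

/-- A family of idempotents of rank `s`, indexed by pairs of classes, which generates all elements
of rank at most `s`. -/
theorem exists_idempotent_generating_set [Finite F] (hAB : Aᵀ = B) (hs : s < A.rank) {K : Type u}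
    (e : K → FrameClass A s × FrameClass B s) (he : ∀ k, FrameRel hAB (e k).1 (e k).2)
    (hchain : ∀ u w, AltChain (FrameRel hAB) (fun u w => ∃ k, e k = (u, w)) u w)
    {T : Subsemigroup (regSandwich A)} (hT : ∀ X, X ∈ T ↔ X.1.toMatrix.rank ≤ s) :
    ∃ Ω : Set (regSandwich A), (∀ X ∈ Ω, IsIdempotentElem X) ∧ Subsemigroup.closure Ω = T ∧
      Cardinal.mk Ω ≤ Cardinal.mk K := by
  choose P Q h hu hw using he
  let ω : K → regSandwich A := fun k =>
    frameMul (isColFrame_of_dual (h k)) (isRowFrame_of_dual (h k)) 1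
  refine ⟨Set.range ω, ?_, le_antisymm ?_ ?_, Cardinal.mk_range_le⟩
  · rintro _ ⟨k, rfl⟩
    exact (isIdempotentElem_frameMul_iff _ _).2 (h k)
  · rw [Subsemigroup.closure_le]
    rintro _ ⟨k, rfl⟩
    exact (hT _).2 ((rank_frameMul_one _ _).trans (Fintype.card_fin s)).le
  · intro X hX
    refine mem_of_altChain hAB hs hchain (fun u w => ?_) X ((hT X).1 hX)
    rintro ⟨k, hk⟩
    exact ⟨P k, Q k, isColFrame_of_dual (h k), isRowFrame_of_dual (h k),
      (hu k).trans (congrArg Prod.fst hk), (hw k).trans (congrArg Prod.snd hk),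
      Subsemigroup.subset_closure ⟨k, rfl⟩⟩

/-- One idempotent is taken for each class on the larger side; when m ≤ n the graph is used with its
sides exchanged and the chains reversed. -/
theorem exists_generating_set_card_le [Finite F] (hAB : Aᵀ = B) (hs : s < A.rank)
    {T : Subsemigroup (regSandwich A)} (hT : ∀ X, X ∈ T ↔ X.1.toMatrix.rank ≤ s) :
    (n ≤ m → ∃ Ω : Set (regSandwich A), (∀ X ∈ Ω, IsIdempotentElem X) ∧
      Subsemigroup.closure Ω = T ∧ Cardinal.mk Ω ≤ Cardinal.mk (FrameClass A s)) ∧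
    (m ≤ n → ∃ Ω : Set (regSandwich A), (∀ X ∈ Ω, IsIdempotentElem X) ∧
      Subsemigroup.closure Ω = T ∧ Cardinal.mk Ω ≤ Cardinal.mk (FrameClass B s)) := by
  have hBA : Bᵀ = A := by rw [← hAB, Matrix.transpose_transpose]
  constructor
  · intro hnm
    obtain ⟨f, hf, hc⟩ := exists_map_altChain_frames hAB hnm hs
    refine exists_idempotent_generating_set hAB hs (fun u => (u, f u)) hf (fun u w => ?_) hT
    convert hc u w using 3
    simp
  · intro hmn
    obtain ⟨f, hf, hc⟩ := exists_map_altChain_frames hBA hmn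
      (by rwa [← hAB, Matrix.rank_transpose] : s < B.rank)
    refine exists_idempotent_generating_set hAB hs (fun w => (f w, w))
      (fun w => frameRel_swap hBA hAB (hf w)) (fun u w => AltChain.swap ?_) hT
    convert hc w u using 3
    · exact frameRel_swap_iff hAB hBA
    · simp

theorem semigroupRank_eq_of_bounds {T : Type u} [Semigroup T] {S : Subsemigroup T}
    {c : Cardinal.{u}} (hlow : ∀ Ω : Set T, Subsemigroup.closure Ω = S → c ≤ Cardinal.mk Ω)
    (hup : ∃ Ω : Set T, (∀ X ∈ Ω, IsIdempotentElem X) ∧ Subsemigroup.closure Ω = S ∧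
      Cardinal.mk Ω ≤ c) :
    semigroupRank S = c ∧ semigroupIdrank S = c := by
  obtain ⟨Ω, hid, hcl, hle⟩ := hup
  constructor
  · refine le_antisymm ((show semigroupRank S ≤ Cardinal.mk Ω from
      csInf_le' ⟨Ω, hcl, rfl⟩).trans hle) (le_csInf ⟨_, Ω, hcl, rfl⟩ ?_)
    rintro _ ⟨Ω', h', rfl⟩
    exact hlow Ω' h'
  · refine le_antisymm ((show semigroupIdrank S ≤ Cardinal.mk Ω from
      csInf_le' ⟨Ω, hid, hcl, rfl⟩).trans hle)
      (le_csInf ⟨_, Ω, hid, hcl, rfl⟩ ?_)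
    rintro _ ⟨Ω', -, h', rfl⟩
    exact hlow Ω' h'

end GeneratingSets

/-! ### Specialization to A = J -/

theorem mainTheorem6 (F : Type u) [Field F] (m n r : ℕ) (hm : 1 ≤ m) (hn : 1 ≤ n)
    (hr : r ≤ min m n) :
    -- the ideals of `P` are precisely the sets `I_s`, for `0 ≤ s ≤ r`
    (∀ I : Set (regP F m n r),
      IsSemigroupIdeal I ↔ ∃ s ≤ r, I = (idealP F m n r s : Set (regP F m n r))) ∧
    -- `I_s = D_0 ∪ ⋯ ∪ D_s`, with top `D`-class `D_s`
    (∀ s ≤ r,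
      (idealP F m n r s : Set (regP F m n r)) = ⋃ t ≤ s, dClassP F m n r t ∧
      IsTopDClass (dClassP F m n r s) (idealP F m n r s : Set (regP F m n r))) ∧
    -- the ideals form a chain
    (∀ s t : ℕ, s ≤ t → t ≤ r → idealP F m n r s ≤ idealP F m n r t) ∧
    -- for `s < r`, `I_s` is generated by the idempotents of `D_s`; its rank and idempotent rank
    (∀ s < r,
      idealP F m n r s =
        Subsemigroup.closure {X | X ∈ dClassP F m n r s ∧ IsIdempotentElem X} ∧
      (Finite F →
        semigroupRank (idealP F m n r s) =
          ((Nat.card F ^ (s * (max m n - r)) * qBinomial (Nat.card F) r s : ℕ) : Cardinal) ∧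
        semigroupIdrank (idealP F m n r s) =
          ((Nat.card F ^ (s * (max m n - r)) * qBinomial (Nat.card F) r s : ℕ) :
            Cardinal))) := by
  have hrm : r ≤ m := hr.trans (min_le_left _ _)
  have hrn : r ≤ n := hr.trans (min_le_right _ _)
  have hJ : (matrixJ F n m r).rank = r := matrixJ_rank hrm hrn
  have hT : ∀ (s : ℕ) (X : regP F m n r), X ∈ idealP F m n r s ↔ X.1.toMatrix.rank ≤ s :=
    fun _ _ => Iff.rfl
  refine ⟨fun I => ?_, fun s hs => ⟨?_, ?_⟩, fun s t hst _ X hX => le_trans hX hst,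
    fun s hs => ⟨?_, fun hF => ?_⟩⟩
  · have h := isSemigroupIdeal_iff I
    rw [hJ] at h
    exact h
  · ext X
    simp only [Set.mem_iUnion, exists_prop]
    exact ⟨fun h => ⟨_, h, rfl⟩, fun ⟨t, ht, h⟩ => (Eq.le h).trans ht⟩
  · exact isTopDClass_rank (hs.trans hJ.ge)
  · apply le_antisymm
    · intro X hX
      refine mem_of_idempotents_mem (hs.trans_eq hJ.symm) (fun P Q h => ?_) X hX
      exact Subsemigroup.subset_closure ⟨(rank_frameMul_one _ _).trans (Fintype.card_fin s),
        (isIdempotentElem_frameMul_iff _ _).2 h⟩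
    · rw [Subsemigroup.closure_le]
      exact fun X hX => le_of_eq hX.1
  · have hs' : s < (matrixJ F n m r).rank := hs.trans_eq hJ.symm
    have hlow := fun Ω : Set (regP F m n r) =>
      mk_frameClass_le_of_closure_eq hs'.le (hT s) (matrixJ_transpose (F := F)) (Ω := Ω)
    have hup := exists_generating_set_card_le (matrixJ_transpose (F := F)) hs' (hT s)
    -- The larger of m and n decides whether R-classes or L-classes bind; the latter are frame
    -- classes of `matrixJ F m n r`, counted with m and n exchanged.
    rcases le_total n m with h | h
    · rw [max_eq_left h, ← card_frameClass_matrixJ hrm hrn hs.le, Nat.cast_card]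
      exact semigroupRank_eq_of_bounds (fun Ω hΩ => (hlow Ω hΩ).1) (hup.1 h)
    · rw [max_eq_right h, ← card_frameClass_matrixJ hrn hrm hs.le, Nat.cast_card]
      exact semigroupRank_eq_of_bounds (fun Ω hΩ => (hlow Ω hΩ).2) (hup.2 h)
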